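/- Let $D\subset\mathbb{R}^d$ be a bounded domain, $(\Omega,P)$ a probability space, and $f\in L^2(D)$. Let $Y(x,\omega)$ be a random field on $D$ with second moment that has a truncated Karhunen–Loève expansion $$Y(x,\omega)=E[Y](x)+\sum_{i=1}^n\sqrt{\lambda_i}\,b_i(x)\,\theta_i(\omega),\qquad (b_i,b_j)_{L^2(D)}=\delta_{ij},\quad \lambda_1\ge\lambda_2\ge\dots\ge\lambda_n\ge 0,$$ with random variables $\theta_i$. Put $\Theta=(\theta_1,\dots,\theta_n)$, $\Theta_0=(\theta_1,\dots,\theta_m)$ with $m<n$, and $$k(x,\Theta)=\exp(Y),\qquad k_0(x,\Theta_0)=\exp\Big(E[Y](x)+\sum_{i=1}^m\sqrt{\lambda_i}\,b_i(x)\,\theta_i\Big),\qquad k_1(x,\Theta)=k(x,\Theta)-k_0(x,\Theta_0).$$ Assume that for almost every $\omega$ there are constants $0<a_0\le a_1$ (which may depend on $\omega$) with $a_0\le k\le a_1$ a.e. in $D$. Let $\mathfrak{T}_h$ be a finite partition of $D$ (up to a null set) into disjoint open cells $K$, and for every $K$ let finitely many functions $l_{K,i}\in H^1(K)$ be given (the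 boundary data; they may depend on $\omega$). For fixed $\omega$ define the following functions on each cell $K$, all equations being understood weakly. * The standard basis function $\phi_{K,i}\in H^1(K)$ solves $-\nabla\cdot(k\nabla\phi_{K,i})=0$ in $K$, $\phi_{K,i}-l_{K,i}\in H^1_0(K)$. * Let $\Pi l_{K,i}\in H_0^1(K)$ be given by $(k_0\nabla\Pi l_{K,i},\nabla w)_K=(k_0\nabla l_{K,i},\nabla w)_K$ for all $w\in H^1_0(K)$, and let $\tilde\xi_j\in H_0^1(K)$, $j\ge0$, solve $-\nabla\cdot(k_0\nabla\tilde\xi_0)=-\nabla\cdot(k_1\nabla(\Pi-I)l_{K,i})$ and $-\nabla\cdot(k_0\nabla\tilde\xi_j)=\nabla\cdot(k_1\nabla\tilde\xi_{j-1})$ for $j\ge 1$. For an integer $J\ge0$ the new basis function is $(\phi_J)_{K,i}=(I-\Pi)l_{K,i}+\sum_{j=0}^J\tilde\xi_j$. Let $V_h(\omega)$, respectively $V_{J,h}(\omega)$, be the space of all $v\in H_0^1(D)$ whose restriction to every cell $K$ is a linear combination of the functions $\phi_{K,i}$, respectively $(\phi_J)_{K,i}$. Let $u$ be a random field that for almost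 every $\omega$ is a weak solution in $H_0^1(D)$ of $-\nabla\cdot(k(x,\omega)\nabla u(x,\omega))=f(x)$ in $D$, $u=0$ on $\partial D$. Let $u_h$ and $u_{J,h}$ be the standard and the new MsFEM solution: random fields with $u_h(\cdot,\omega)\in V_h(\omega)$ and $u_{J,h}(\cdot,\omega)\in V_{J,h}(\omega)$ for almost every $\omega$, such that, for almost every $\omega$, $$(k\nabla u_h,\nabla w)_D=(f,w)_D\ \ \forall w\in V_h(\omega),\qquad (k\nabla u_{J,h},\nabla w)_D=(f,w)_D\ \ \forall w\in V_{J,h}(\omega).$$ **Theorem.** If $\eta:=\big\|\tfrac{k_1}{k_0}\big\|_{L^\infty(D\times\Omega)}<1$, then $$\|\sqrt{k}\,\nabla(u_h-u_{J,h})\|_{L^2(D)\otimes L^2(\Omega)}\le \tilde c^{\,1/2}\Big(\eta^{J+1}+\frac{\eta^{J+1}}{1-\eta^{J+1}}\Big)^{1/2}\|\sqrt{k}\,\nabla u\|_{L^2(D)\otimes L^2(\Omega)},\qquad \tilde c=\sqrt2\,\Big\|\sqrt{\tfrac{k_0}{k}}\Big\|_{L^\infty(D\times\Omega)}.$$ (The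 right-hand side may be infinite; products $0\cdot\infty$ are read as $0$.) -/

import Mathlib

open MeasureTheory Filter Topology
open scoped ENNReal

noncomputable section

namespace MsFEM

/-! ## Sobolev spaces -/

/-- The Euclidean space `ℝ^d`. -/
abbrev E (d : ℕ) : Type := EuclideanSpace ℝ (Fin d)

/-- A scalar function `p.1` on `ℝ^d` together with its (weak) gradient `p.2`. That the second
component really is the gradient on a given open set is part of `MemH1` and `MemH10` below. -/
abbrev Fun (d : ℕ) : Type := (E d → ℝ) × (E d → E d)

/-- `ψ ∈ C_c^∞(U)`. -/
def IsTestFunction {d : ℕ} (U : Set (E d)) (ψ : E d → ℝ) : Prop :=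
  ContDiff ℝ ((⊤ : ℕ∞) : WithTop ℕ∞) ψ ∧ HasCompactSupport ψ ∧ tsupport ψ ⊆ U

/-- `p.1 ∈ H¹(U)` with weak gradient `p.2`. -/
def MemH1 {d : ℕ} (U : Set (E d)) (p : Fun d) : Prop :=
  MemLp p.1 2 (volume.restrict U) ∧ MemLp p.2 2 (volume.restrict U) ∧
  ∀ ψ : E d → ℝ, IsTestFunction U ψ → ∀ i : Fin d,
    ∫ x in U, p.1 x * (gradient ψ x) i = - ∫ x in U, (p.2 x) i * ψ x

/-- `p.1 ∈ H₀¹(U)` with weak gradient `p.2`: `H₀¹(U)` is the closure of `C_c^∞(U)` in `H¹(U)`. -/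
def MemH10 {d : ℕ} (U : Set (E d)) (p : Fun d) : Prop :=
  MemLp p.1 2 (volume.restrict U) ∧ MemLp p.2 2 (volume.restrict U) ∧
  ∃ ψ : ℕ → E d → ℝ, (∀ n, IsTestFunction U (ψ n)) ∧
    Tendsto (fun n => eLpNorm (fun x => p.1 x - ψ n x) 2 (volume.restrict U)) atTop (𝓝 0) ∧
    Tendsto (fun n => eLpNorm (fun x => p.2 x - gradient (ψ n) x) 2 (volume.restrict U))
      atTop (𝓝 0)

/-- The bilinear form `(κ ∇p, ∇q)_U = ∫_U κ ∇p · ∇q dx`. -/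
def form {d : ℕ} (κ : E d → ℝ) (U : Set (E d)) (p q : Fun d) : ℝ :=
  ∫ x in U, κ x * inner ℝ (p.2 x) (q.2 x)

/-! ## The coarse partition, the basis functions and the finite element spaces -/

/-- A partition of `D` into open cells. -/
structure IsPartition {d : ℕ} {ι : Type*} (D : Set (E d)) (cell : ι → Set (E d)) : Prop where
  isOpen : ∀ j, IsOpen (cell j)
  subset : ∀ j, cell j ⊆ D
  disjoint : ∀ i j, i ≠ j → Disjoint (cell i) (cell j)
  cover : volume (D \ ⋃ j, cell j) = 0

/-- `φ` is the standard multiscale basis function on the cell `K` for the boundary data `l`: the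
weak solution of `-∇·(k∇φ) = 0` in `K`, `φ = l` on `∂K`. -/
def IsStdBasis {d : ℕ} (k : E d → ℝ) (K : Set (E d)) (l φ : Fun d) : Prop :=
  MemH1 K φ ∧ MemH10 K (φ - l) ∧ ∀ w, MemH10 K w → form k K φ w = 0

/-- `φ` is the new multiscale basis function `φ_J = (I - Π) l + ∑_{j ≤ J} ξ_j` on the cell `K`,
for the splitting `k = k₀ + k₁`. Here `πl = Π l` is the `k₀`-elliptic projection of `l` to
`H₀¹(K)`, and the bubble functions `ξ_j` vanish on `∂K` and are the weak solutions of
`-∇·(k₀∇ξ_0) = -∇·(k₁∇(Π - I) l)` and `-∇·(k₀∇ξ_{j+1}) = ∇·(k₁∇ξ_j)` in `K`. -/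
def IsNewBasis {d : ℕ} (k₀ k₁ : E d → ℝ) (J : ℕ) (K : Set (E d)) (l φ : Fun d) : Prop :=
  ∃ (πl : Fun d) (ξ : ℕ → Fun d),
    (MemH10 K πl ∧ ∀ w, MemH10 K w → form k₀ K πl w = form k₀ K l w) ∧
    (MemH10 K (ξ 0) ∧ ∀ w, MemH10 K w → form k₀ K (ξ 0) w = form k₁ K (πl - l) w) ∧
    (∀ j, MemH10 K (ξ (j + 1)) ∧
      ∀ w, MemH10 K w → form k₀ K (ξ (j + 1)) w = - form k₁ K (ξ j) w) ∧
    φ = (l - πl) + ∑ j ∈ Finset.range (J + 1), ξ j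

/-- The conforming finite element space with prescribed local basis functions: the members of
`H₀¹(D)` which on every cell `cell j` are linear combinations of the local basis functions
(`isBasis j i φ` says that `φ` is a local basis function of the cell `j` for the vertex `i`). -/
def feSpace {d : ℕ} {ι ν : Type*} (D : Set (E d)) (cell : ι → Set (E d))
    (isBasis : ι → ν → Fun d → Prop) : Set (Fun d) :=
  {v | MemH10 D v ∧ ∀ j, ∃ w ∈ Submodule.span ℝ {φ | ∃ i, isBasis j i φ},
    v.1 =ᵐ[volume.restrict (cell j)] w.1 ∧ v.2 =ᵐ[volume.restrict (cell j)] w.2}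

/-- The standard MsFEM space `V_h`. -/
def stdSpace {d : ℕ} {ι ν : Type*} (D : Set (E d)) (cell : ι → Set (E d))
    (l : ι → ν → Fun d) (k : E d → ℝ) : Set (Fun d) :=
  feSpace D cell (fun j i φ => IsStdBasis k (cell j) (l j i) φ)

/-- The new MsFEM space `V_{J,h}`. -/
def newSpace {d : ℕ} {ι ν : Type*} (D : Set (E d)) (cell : ι → Set (E d))
    (l : ι → ν → Fun d) (k₀ k₁ : E d → ℝ) (J : ℕ) : Set (Fun d) :=
  feSpace D cell (fun j i φ => IsNewBasis k₀ k₁ J (cell j) (l j i) φ)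

/-! ## The random coefficient -/

section Random

variable {Ω : Type*} [MeasurableSpace Ω]

/-- A truncated Karhunen–Loève expansion
`Y(x, ω) = E[Y](x) + ∑_{i < n} √λ_i b_i(x) θ_i(ω)` of a random field on `D` with second moment. -/
structure TruncatedKL {d : ℕ} (D : Set (E d)) (P : Measure Ω) (Y : E d → Ω → ℝ) (n : ℕ) where
  lam : Fin n → ℝ
  b : Fin n → E d → ℝ
  θ : Fin n → Ω → ℝ
  measurable_Y : Measurable (Function.uncurry Y)
  second_moment : ∀ᵐ x ∂(volume.restrict D), MemLp (Y x) 2 P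
  lam_nonneg : ∀ i, 0 ≤ lam i
  lam_antitone : Antitone lam
  b_memLp : ∀ i, MemLp (b i) 2 (volume.restrict D)
  b_orthonormal : ∀ i j, ∫ x in D, b i x * b j x = if i = j then 1 else 0
  θ_measurable : ∀ i, Measurable (θ i)
  expansion : ∀ᵐ z ∂((volume.restrict D).prod P),
    Y z.1 z.2 = (∫ ω, Y z.1 ω ∂P) + ∑ i, √(lam i) * b i z.1 * θ i z.2

/-- The log-field coefficient `k = exp Y`. -/
def coeff {d : ℕ} (Y : E d → Ω → ℝ) (x : E d) (ω : Ω) : ℝ := Real.exp (Y x ω)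

/-- `k₀(x, Θ₀) = exp (E[Y] + ∑_{i ≤ m} √λ_i b_i(x) θ_i)`, the part of the coefficient that only
involves the first `m` random variables (indices start at `0` here). -/
def TruncatedKL.coeff₀ {d : ℕ} {D : Set (E d)} {P : Measure Ω} {Y : E d → Ω → ℝ} {n : ℕ}
    (kl : TruncatedKL D P Y n) (m : ℕ) (x : E d) (ω : Ω) : ℝ :=
  Real.exp ((∫ ω', Y x ω' ∂P) +
    ∑ i with (i : Fin n).val < m, √(kl.lam i) * kl.b i x * kl.θ i ω)

/-- `k₁ = k - k₀`. -/
def TruncatedKL.coeff₁ {d : ℕ} {D : Set (E d)} {P : Measure Ω} {Y : E d → Ω → ℝ} {n : ℕ}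
    (kl : TruncatedKL D P Y n) (m : ℕ) (x : E d) (ω : Ω) : ℝ :=
  coeff Y x ω - kl.coeff₀ m x ω

/-! ## Random fields, solutions and norms -/

/-- A random field: the function and its gradient are jointly measurable on `D × Ω`
(up to null sets). -/
def IsRandomField {d : ℕ} (D : Set (E d)) (P : Measure Ω) (u : Ω → Fun d) : Prop :=
  AEStronglyMeasurable (fun z : E d × Ω => (u z.2).1 z.1) ((volume.restrict D).prod P) ∧
  AEStronglyMeasurable (fun z : E d × Ω => (u z.2).2 z.1) ((volume.restrict D).prod P)

/-- `u` is a random field which, almost surely, belongs to the space `V ω` and satisfies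
`(k(·,ω) ∇u(·,ω), ∇w) = (f, w)` for all `w ∈ V ω`. For `V ω = H₀¹(D)` this is the weak solution of
`-∇·(k∇u) = f` in `D`, `u = 0` on `∂D`; for a finite element space it is the Galerkin solution. -/
def IsGalerkinSolution {d : ℕ} (D : Set (E d)) (P : Measure Ω) (k : E d → Ω → ℝ) (f : E d → ℝ)
    (V : Ω → Set (Fun d)) (u : Ω → Fun d) : Prop :=
  IsRandomField D P u ∧
  ∀ᵐ ω ∂P, u ω ∈ V ω ∧
    ∀ w ∈ V ω, form (fun x => k x ω) D (u ω) w = ∫ x in D, f x * w.1 x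

/-- The norm `‖√k ∇v‖_{L²(D) ⊗ L²(Ω)}`. -/
def energyNorm {d : ℕ} (D : Set (E d)) (P : Measure Ω) (k : E d → Ω → ℝ) (v : Ω → Fun d) : ℝ≥0∞ :=
  eLpNorm (fun z : E d × Ω => √(k z.1 z.2) • (v z.2).2 z.1) 2 ((volume.restrict D).prod P)

/-- The norm `‖g‖_{L^∞(D × Ω)}`. -/
def supNorm {d : ℕ} (D : Set (E d)) (P : Measure Ω) (g : E d → Ω → ℝ) : ℝ≥0∞ :=
  eLpNorm (fun z : E d × Ω => g z.1 z.2) ⊤ ((volume.restrict D).prod P)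

end Random

end MsFEM

end

noncomputable section

namespace MsFEM

section

variable {d : ℕ}

/-! ## The weighted form on gradients -/

/-! For fixed `ω` both discrete solutions are Galerkin projections of the same `u` in the `k`-energy
inner product, onto two different spaces. The proof compares the spaces cell by cell and then sees
how far the projections can be apart.

Local comparison (`IsNewBasis.sub_isStdBasis`). For given boundary data let `ρ n` be the standard
function minus `(I - Π) l` minus the first `n` bubbles. It lies in `H₀¹(K)`, and `ρ 0` is the
`k₀`-projection of the standard function `φ`. Since `φ` is `k`-harmonic, `(k₀∇ρ (n+1), ∇w) = -(k₁∇ρ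
n, ∇w)` for all bubbles `w`. As `|k₁| ≤ η k₀`, each step contracts the `k₀`-energy norm by `η`, so
`J + 1` bubbles leave an error of at most `η^(J+1)` times that of `φ`.

Global comparison (`IsCompanion`). The boundary data match, so replacing the standard local
functions by the new ones, or conversely, changes a function only by bubbles on the cells and stays
in `H₀¹(D)`. Every member of either space thus has a companion in the other.

Galerkin argument (`norm_sub_sq_le_of_galerkin`). Let `zh` carry `uh` to its companion in the new
space and let `uJ - zJ` be the companion of `uJ` in the standard space. Because `uh` is
`k`-orthogonal to cell bubbles, `‖uh - uJ‖² = -(u - uJ, zh) + (u, zJ)`. The two terms yield the two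
summands of the constant. The estimate is linear in the size of the corrections, hence the square
root in the theorem.

Companions exist only if the local problems are solvable. This is proved from the Poincaré
inequality and an orthogonal projection in `L²`. Finally the estimate is integrated over `Ω` by
Tonelli. -/

theorem integrable_weighted_inner {α : Type*} [MeasurableSpace α] {μ : Measure α}
    {κ : α → ℝ} {g h : α → E d} (hκ : MemLp κ ⊤ μ) (hg : MemLp g 2 μ) (hh : MemLp h 2 μ) :
    Integrable (fun x => κ x * inner ℝ (g x) (h x)) μ := by
  have h1 : MemLp (κ • g) 2 μ := hg.smul hκ
  have h2 := L2.integrable_inner (𝕜 := ℝ) (h1.toLp _) (hh.toLp _)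
  refine h2.congr ?_
  filter_upwards [h1.coeFn_toLp, hh.coeFn_toLp] with x hx1 hx2
  rw [hx1, hx2, Pi.smul_apply', real_inner_smul_left]

theorem form_comm (κ : E d → ℝ) (U : Set (E d)) (p q : Fun d) :
    form κ U p q = form κ U q p := by
  simp only [form, real_inner_comm]

theorem form_smul_left (κ : E d → ℝ) (U : Set (E d)) (c : ℝ) (p q : Fun d) :
    form κ U (c • p) q = c * form κ U p q := by
  simp only [form, ← integral_const_mul]
  congr 1 with x
  simp only [Prod.smul_snd, Pi.smul_apply, real_inner_smul_left]
  ring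

theorem form_neg_left (κ : E d → ℝ) (U : Set (E d)) (p q : Fun d) :
    form κ U (-p) q = -form κ U p q := by
  rw [← neg_one_smul ℝ p, form_smul_left, neg_one_mul]

theorem form_zero_left (κ : E d → ℝ) (U : Set (E d)) (q : Fun d) :
    form κ U 0 q = 0 := by
  simp [form]

section

variable {κ κ' : E d → ℝ} {U : Set (E d)} {p q r : Fun d}

theorem form_add_left (hκ : MemLp κ ⊤ (volume.restrict U))
    (hp : MemLp p.2 2 (volume.restrict U)) (hq : MemLp q.2 2 (volume.restrict U))
    (hr : MemLp r.2 2 (volume.restrict U)) :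
    form κ U (p + q) r = form κ U p r + form κ U q r := by
  simp only [form]
  rw [← integral_add (integrable_weighted_inner hκ hp hr) (integrable_weighted_inner hκ hq hr)]
  congr 1 with x
  simp only [Prod.snd_add, Pi.add_apply, inner_add_left]
  ring

theorem form_sub_left (hκ : MemLp κ ⊤ (volume.restrict U))
    (hp : MemLp p.2 2 (volume.restrict U)) (hq : MemLp q.2 2 (volume.restrict U))
    (hr : MemLp r.2 2 (volume.restrict U)) :
    form κ U (p - q) r = form κ U p r - form κ U q r := by
  rw [sub_eq_add_neg, form_add_left hκ hp (by simpa using hq.neg) hr, form_neg_left, sub_eq_add_neg]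

theorem form_sub_coeff (hκ : MemLp κ ⊤ (volume.restrict U)) (hκ' : MemLp κ' ⊤ (volume.restrict U))
    (hp : MemLp p.2 2 (volume.restrict U)) (hq : MemLp q.2 2 (volume.restrict U)) :
    form (fun x => κ x - κ' x) U p q = form κ U p q - form κ' U p q := by
  simp only [form]
  rw [← integral_sub (integrable_weighted_inner hκ hp hq) (integrable_weighted_inner hκ' hp hq)]
  congr 1 with x
  ring

theorem form_self_le_mul (hκ : MemLp κ ⊤ (volume.restrict U))
    (hκ' : MemLp κ' ⊤ (volume.restrict U)) {c : ℝ}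
    (h : ∀ᵐ x ∂(volume.restrict U), κ x ≤ c * κ' x) (hp : MemLp p.2 2 (volume.restrict U)) :
    form κ U p p ≤ c * form κ' U p p := by
  simp only [form, ← integral_const_mul]
  refine integral_mono_ae (integrable_weighted_inner hκ hp hp)
    ((integrable_weighted_inner hκ' hp hp).const_mul c) ?_
  filter_upwards [h] with x hx
  calc κ x * inner ℝ (p.2 x) (p.2 x) ≤ (c * κ' x) * inner ℝ (p.2 x) (p.2 x) :=
        mul_le_mul_of_nonneg_right hx real_inner_self_nonneg
    _ = _ := by ring

theorem form_congr {p' q' : Fun d} (hp : p.2 =ᵐ[volume.restrict U] p'.2)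
    (hq : q.2 =ᵐ[volume.restrict U] q'.2) : form κ U p q = form κ U p' q' := by
  refine integral_congr_ae ?_
  filter_upwards [hp, hq] with x hx hy
  rw [hx, hy]

/-- A variational identity against the solution itself bounds its energy. -/
theorem form_self_le_of_form_self_eq {η : ℝ} (hη : 0 ≤ η) (hκ : MemLp κ ⊤ (volume.restrict U))
    (hκ' : MemLp κ' ⊤ (volume.restrict U))
    (h : ∀ᵐ x ∂(volume.restrict U), |κ' x| ≤ η * κ x) (h0 : ∀ᵐ x ∂(volume.restrict U), 0 ≤ κ x)
    (hp : MemLp p.2 2 (volume.restrict U)) (hq : MemLp q.2 2 (volume.restrict U))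
    (heq : form κ U p p = form κ' U q p) : form κ U p p ≤ η ^ 2 * form κ U q q := by
  -- Young's inequality with weights `η² / 2` and `1 / 2`: the second term is absorbed by the
  -- left-hand side, and doubling gives exactly `η²`.
  have key : form κ' U q p ≤ η ^ 2 / 2 * form κ U q q + 1 / 2 * form κ U p p := by
    simp only [form, ← integral_const_mul]
    rw [← integral_add ((integrable_weighted_inner hκ hq hq).const_mul _)
      ((integrable_weighted_inner hκ hp hp).const_mul _)]
    refine integral_mono_ae (integrable_weighted_inner hκ' hq hp)
      (((integrable_weighted_inner hκ hq hq).const_mul _).add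
      ((integrable_weighted_inner hκ hp hp).const_mul _)) ?_
    filter_upwards [h, h0] with x hx hx0
    simp only [real_inner_self_eq_norm_sq]
    have h1 : κ' x * inner ℝ (q.2 x) (p.2 x) ≤ (η * κ x) * (‖q.2 x‖ * ‖p.2 x‖) := by
      refine (le_abs_self _).trans ?_
      rw [abs_mul]
      exact mul_le_mul hx (abs_real_inner_le_norm _ _) (abs_nonneg _) (by positivity)
    have h2 := mul_nonneg hx0 (sq_nonneg (η * ‖q.2 x‖ - ‖p.2 x‖))
    linarith
  linarith

end

/-! ## The space `H₀¹` -/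

section

variable {U V : Set (E d)}

theorem IsTestFunction.add {ψ χ : E d → ℝ} (hψ : IsTestFunction U ψ) (hχ : IsTestFunction U χ) :
    IsTestFunction U (ψ + χ) :=
  ⟨hψ.1.add hχ.1, hψ.2.1.add hχ.2.1,
    (tsupport_add ψ χ).trans (Set.union_subset hψ.2.2 hχ.2.2)⟩

theorem IsTestFunction.smul {ψ : E d → ℝ} (c : ℝ) (hψ : IsTestFunction U ψ) :
    IsTestFunction U (c • ψ) :=
  ⟨hψ.1.const_smul c, hψ.2.1.smul_left (f := fun _ => c),
    (closure_mono (Function.support_const_smul_subset c ψ)).trans hψ.2.2⟩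

theorem isTestFunction_zero : IsTestFunction U (0 : E d → ℝ) :=
  ⟨contDiff_const, HasCompactSupport.zero, by simp [tsupport]⟩

theorem IsTestFunction.mono {ψ : E d → ℝ} (hUV : U ⊆ V) (hψ : IsTestFunction U ψ) :
    IsTestFunction V ψ :=
  ⟨hψ.1, hψ.2.1, hψ.2.2.trans hUV⟩

theorem IsTestFunction.differentiable {ψ : E d → ℝ} (hψ : IsTestFunction U ψ) :
    Differentiable ℝ ψ :=
  hψ.1.differentiable (by simp)

theorem gradient_eq_toDual_symm (ψ : E d → ℝ) (x : E d) :
    gradient ψ x = (InnerProductSpace.toDual ℝ (E d)).symm (fderiv ℝ ψ x) := rfl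

theorem IsTestFunction.gradient_add {ψ χ : E d → ℝ} (hψ : IsTestFunction U ψ)
    (hχ : IsTestFunction U χ) : gradient (ψ + χ) = gradient ψ + gradient χ := by
  ext1 x
  simp only [gradient_eq_toDual_symm, Pi.add_apply,
    fderiv_add (hψ.differentiable x) (hχ.differentiable x), map_add]

theorem IsTestFunction.gradient_smul {ψ : E d → ℝ} (c : ℝ) (hψ : IsTestFunction U ψ) :
    gradient (c • ψ) = c • gradient ψ := by
  ext1 x
  simp only [gradient_eq_toDual_symm, Pi.smul_apply, fderiv_const_smul (hψ.differentiable x),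
    map_smul]

theorem IsTestFunction.continuous_gradient {ψ : E d → ℝ} (hψ : IsTestFunction U ψ) :
    Continuous (gradient ψ) :=
  (InnerProductSpace.toDual ℝ (E d)).symm.continuous.comp (hψ.1.continuous_fderiv (by simp))

theorem gradient_eq_zero_of_notMem_tsupport {ψ : E d → ℝ} {x : E d} (hx : x ∉ tsupport ψ) :
    gradient ψ x = 0 := by
  rw [gradient_eq_toDual_symm, fderiv_of_notMem_tsupport ℝ hx, map_zero]

theorem IsTestFunction.hasCompactSupport_gradient {ψ : E d → ℝ} (hψ : IsTestFunction U ψ) :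
    HasCompactSupport (gradient ψ) :=
  HasCompactSupport.intro hψ.2.1 fun _ hx => gradient_eq_zero_of_notMem_tsupport hx

theorem IsTestFunction.memLp {ψ : E d → ℝ} (hψ : IsTestFunction U ψ) (p : ℝ≥0∞)
    (V : Set (E d)) : MemLp ψ p (volume.restrict V) :=
  (hψ.1.continuous.memLp_of_hasCompactSupport hψ.2.1).restrict V

theorem IsTestFunction.memLp_gradient {ψ : E d → ℝ} (hψ : IsTestFunction U ψ) (p : ℝ≥0∞)
    (V : Set (E d)) : MemLp (gradient ψ) p (volume.restrict V) :=
  (hψ.continuous_gradient.memLp_of_hasCompactSupport hψ.hasCompactSupport_gradient).restrict V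

theorem tendsto_eLpNorm_add_of_tendsto {α F : Type*} [MeasurableSpace α] {μ : Measure α}
    [NormedAddCommGroup F] {f g : α → F} {φ χ : ℕ → α → F}
    (hf : ∀ n, AEStronglyMeasurable (fun x => f x - φ n x) μ)
    (hg : ∀ n, AEStronglyMeasurable (fun x => g x - χ n x) μ)
    (h : Tendsto (fun n => eLpNorm (fun x => f x - φ n x) 2 μ) atTop (𝓝 0))
    (h' : Tendsto (fun n => eLpNorm (fun x => g x - χ n x) 2 μ) atTop (𝓝 0)) :
    Tendsto (fun n => eLpNorm (fun x => (f + g) x - (φ n + χ n) x) 2 μ) atTop (𝓝 0) := by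
  refine tendsto_of_tendsto_of_tendsto_of_le_of_le tendsto_const_nhds
    (by simpa using h.add h') (fun _ => zero_le) fun n => ?_
  refine le_trans (le_of_eq ?_) (eLpNorm_add_le (hf n) (hg n) (by norm_num))
  congr 1 with x
  simp only [Pi.add_apply]
  abel

theorem tendsto_eLpNorm_smul_of_tendsto {α F : Type*} [MeasurableSpace α] {μ : Measure α}
    [NormedAddCommGroup F] [NormedSpace ℝ F] {f : α → F} {φ : ℕ → α → F} (c : ℝ)
    (h : Tendsto (fun n => eLpNorm (fun x => f x - φ n x) 2 μ) atTop (𝓝 0)) :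
    Tendsto (fun n => eLpNorm (fun x => (c • f) x - (c • φ n) x) 2 μ) atTop (𝓝 0) := by
  have h1 : ∀ n, eLpNorm (fun x => (c • f) x - (c • φ n) x) 2 μ =
      ‖c‖ₑ * eLpNorm (fun x => f x - φ n x) 2 μ := fun n => by
    rw [← eLpNorm_const_smul]
    congr 1 with x
    simp [smul_sub]
  simp only [h1]
  simpa using ENNReal.Tendsto.const_mul h (Or.inr (by simp))

theorem MemH10.add {p q : Fun d} (hp : MemH10 U p) (hq : MemH10 U q) : MemH10 U (p + q) := by
  obtain ⟨hp1, hp2, ψ, hψ, hψ1, hψ2⟩ := hp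
  obtain ⟨hq1, hq2, χ, hχ, hχ1, hχ2⟩ := hq
  refine ⟨hp1.add hq1, hp2.add hq2, fun n => ψ n + χ n, fun n => (hψ n).add (hχ n), ?_, ?_⟩
  · exact tendsto_eLpNorm_add_of_tendsto
      (fun n => (hp1.sub ((hψ n).memLp 2 U)).1) (fun n => (hq1.sub ((hχ n).memLp 2 U)).1) hψ1 hχ1
  · simp only [fun n => (hψ n).gradient_add (hχ n)]
    exact tendsto_eLpNorm_add_of_tendsto (fun n => (hp2.sub ((hψ n).memLp_gradient 2 U)).1)
      (fun n => (hq2.sub ((hχ n).memLp_gradient 2 U)).1) hψ2 hχ2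

theorem MemH10.smul {p : Fun d} (c : ℝ) (hp : MemH10 U p) : MemH10 U (c • p) := by
  obtain ⟨hp1, hp2, ψ, hψ, hψ1, hψ2⟩ := hp
  refine ⟨hp1.const_smul c, hp2.const_smul c, fun n => c • ψ n, fun n => (hψ n).smul c, ?_, ?_⟩
  · exact tendsto_eLpNorm_smul_of_tendsto c hψ1
  · simp only [fun n => (hψ n).gradient_smul c]
    exact tendsto_eLpNorm_smul_of_tendsto c hψ2

theorem MemH10.neg {p : Fun d} (hp : MemH10 U p) : MemH10 U (-p) := by
  simpa using hp.smul (-1)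

theorem MemH10.sub {p q : Fun d} (hp : MemH10 U p) (hq : MemH10 U q) : MemH10 U (p - q) := by
  simpa [sub_eq_add_neg] using hp.add hq.neg

theorem IsTestFunction.memH10 {ψ : E d → ℝ} (hψ : IsTestFunction U ψ) :
    MemH10 U (ψ, gradient ψ) :=
  ⟨hψ.memLp 2 U, hψ.memLp_gradient 2 U, fun _ => ψ, fun _ => hψ, by simp, by simp⟩

theorem memH10_zero : MemH10 U (0 : Fun d) := by
  have h := (isTestFunction_zero (U := U)).memH10
  have h0 : gradient (0 : E d → ℝ) = 0 := by
    ext1 x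
    simp [gradient_eq_toDual_symm]
  rwa [h0] at h

theorem MemH10.sum {ι : Type*} (s : Finset ι) {p : ι → Fun d} (hp : ∀ j, MemH10 U (p j)) :
    MemH10 U (∑ j ∈ s, p j) :=
  Finset.sum_induction p (MemH10 U) (fun _ _ => MemH10.add) memH10_zero fun j _ => hp j

/-- Extension by zero maps `H₀¹(U)` to `H₀¹(V)` for `U ⊆ V`. -/
theorem MemH10.indicator (hU : MeasurableSet U) (hUV : U ⊆ V) {p : Fun d} (hp : MemH10 U p) :
    MemH10 V (U.indicator p.1, U.indicator p.2) := by
  obtain ⟨hp1, hp2, ψ, hψ, hψ1, hψ2⟩ := hp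
  -- The approximating test functions and their gradients already vanish off `U`, so the
  -- approximation error on `V` equals that on `U`.
  have aux : ∀ {F : Type} [NormedAddCommGroup F] (g φ : E d → F), (∀ x, x ∉ U → φ x = 0) →
      eLpNorm (fun x => U.indicator g x - φ x) 2 (volume.restrict V) =
        eLpNorm (fun x => g x - φ x) 2 (volume.restrict U) := by
    intro F _ g φ hφ
    have : (fun x => U.indicator g x - φ x) = U.indicator (fun x => g x - φ x) := by
      ext x
      by_cases hx : x ∈ U
      · simp [hx]
      · simp [hx, hφ x hx]
    rw [this, eLpNorm_indicator_eq_eLpNorm_restrict hU, Measure.restrict_restrict hU,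
      Set.inter_eq_left.2 hUV]
  have hm : ∀ {F : Type} [NormedAddCommGroup F] (g : E d → F), MemLp g 2 (volume.restrict U) →
      MemLp (U.indicator g) 2 (volume.restrict V) := by
    intro F _ g hg
    rw [memLp_indicator_iff_restrict hU, Measure.restrict_restrict hU, Set.inter_eq_left.2 hUV]
    exact hg
  refine ⟨hm _ hp1, hm _ hp2, ψ, fun n => (hψ n).mono hUV, ?_, ?_⟩
  · refine hψ1.congr fun n => (aux p.1 (ψ n) fun x hx => ?_).symm
    exact image_eq_zero_of_notMem_tsupport fun h => hx ((hψ n).2.2 h)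
  · refine hψ2.congr fun n => (aux p.2 (gradient (ψ n)) fun x hx => ?_).symm
    exact gradient_eq_zero_of_notMem_tsupport fun h => hx ((hψ n).2.2 h)

end

/-! ### Pointwise bounds from `L^∞` norms. -/

theorem ae_norm_le_toReal_eLpNorm_top {α F : Type*} [MeasurableSpace α] {μ : Measure α}
    [NormedAddCommGroup F] {f : α → F} (hf : eLpNorm f ⊤ μ ≠ ⊤) :
    ∀ᵐ x ∂μ, ‖f x‖ ≤ (eLpNorm f ⊤ μ).toReal := by
  rw [eLpNorm_exponent_top] at hf ⊢
  filter_upwards [ae_le_eLpNormEssSup (f := f) (μ := μ)] with x hx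
  simpa using ENNReal.toReal_mono hf hx

theorem memLp_top_sqrt {α : Type*} [MeasurableSpace α] {μ : Measure α} {κ : α → ℝ}
    (hκ : MemLp κ ⊤ μ) : MemLp (fun x => √(κ x)) ⊤ μ := by
  refine memLp_top_of_bound (Real.continuous_sqrt.comp_aestronglyMeasurable hκ.1)
    (√(eLpNorm κ ⊤ μ).toReal) ?_
  filter_upwards [ae_norm_le_toReal_eLpNorm_top hκ.2.ne] with x hx
  rw [Real.norm_of_nonneg (Real.sqrt_nonneg _)]
  exact Real.sqrt_le_sqrt ((le_abs_self _).trans hx)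

/-! ## Convergence in `L²` -/

section

variable {α F : Type*} [MeasurableSpace α] {μ : Measure α} [NormedAddCommGroup F]

theorem tendsto_toLp_iff {f : α → F} {φ : ℕ → α → F} (hφ : ∀ n, MemLp (φ n) 2 μ)
    (hf : MemLp f 2 μ) :
    Tendsto (fun n => (hφ n).toLp (φ n)) atTop (𝓝 (hf.toLp f)) ↔
      Tendsto (fun n => eLpNorm (fun x => f x - φ n x) 2 μ) atTop (𝓝 0) := by
  rw [Lp.tendsto_Lp_iff_tendsto_eLpNorm'' φ hφ f hf]
  refine tendsto_congr fun n => ?_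
  exact eLpNorm_sub_comm (φ n) f 2 μ

theorem tendsto_eLpNorm_mul_of_tendsto [NormedSpace ℝ F] {κ : α → ℝ} {f : α → F} {φ : ℕ → α → F}
    (hκ : MemLp κ ⊤ μ) (hφ : ∀ n, MemLp (φ n) 2 μ) (hf : MemLp f 2 μ)
    (h : Tendsto (fun n => eLpNorm (fun x => f x - φ n x) 2 μ) atTop (𝓝 0)) :
    Tendsto (fun n => eLpNorm (fun x => κ x • f x - κ x • φ n x) 2 μ) atTop (𝓝 0) := by
  have h1 : Tendsto (fun n => eLpNorm κ ⊤ μ * eLpNorm (fun x => f x - φ n x) 2 μ) atTop (𝓝 0) := by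
    simpa using ENNReal.Tendsto.const_mul h (Or.inr hκ.2.ne)
  refine tendsto_of_tendsto_of_tendsto_of_le_of_le tendsto_const_nhds h1
    (fun _ => zero_le) fun n => ?_
  have := eLpNorm_smul_le_mul_eLpNorm (p := ⊤) (q := 2) (r := 2) (hf.sub (hφ n)).1 hκ.1
  refine le_trans (le_of_eq ?_) this
  congr 1 with x
  simp [smul_sub]

variable [InnerProductSpace ℝ F]

theorem inner_toLp {f g : α → F} (hf : MemLp f 2 μ) (hg : MemLp g 2 μ) :
    inner ℝ (hf.toLp f) (hg.toLp g) = ∫ x, inner ℝ (f x) (g x) ∂μ := by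
  rw [L2.inner_def]
  refine integral_congr_ae ?_
  filter_upwards [hf.coeFn_toLp, hg.coeFn_toLp] with x hx hy
  rw [hx, hy]

theorem tendsto_integral_inner {f g : α → F} {φ : ℕ → α → F} (hg : MemLp g 2 μ)
    (hφ : ∀ n, MemLp (φ n) 2 μ) (hf : MemLp f 2 μ)
    (h : Tendsto (fun n => eLpNorm (fun x => f x - φ n x) 2 μ) atTop (𝓝 0)) :
    Tendsto (fun n => ∫ x, inner ℝ (g x) (φ n x) ∂μ) atTop (𝓝 (∫ x, inner ℝ (g x) (f x) ∂μ)) := by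
  have := (tendsto_const_nhds (x := hg.toLp g)).inner (𝕜 := ℝ) ((tendsto_toLp_iff hφ hf).2 h)
  simpa only [inner_toLp] using this

end

/-! ## Integration by parts and the Poincaré inequality -/

section

variable {U : Set (E d)}

theorem gradient_apply (ψ : E d → ℝ) (x : E d) (i : Fin d) :
    gradient ψ x i = fderiv ℝ ψ x (EuclideanSpace.single i 1) := by
  rw [← inner_gradient_left, EuclideanSpace.inner_single_right]
  simp

theorem IsTestFunction.setIntegral_mul_gradient {ψ χ : E d → ℝ} (hψ : IsTestFunction U ψ)
    (hχ : IsTestFunction U χ) (i : Fin d) :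
    ∫ x in U, ψ x * gradient χ x i = -∫ x in U, gradient ψ x i * χ x := by
  have hψ0 : ∀ x, x ∉ U → ψ x = 0 := fun x hx =>
    image_eq_zero_of_notMem_tsupport fun h => hx (hψ.2.2 h)
  have hχ0 : ∀ x, x ∉ U → χ x = 0 := fun x hx =>
    image_eq_zero_of_notMem_tsupport fun h => hx (hχ.2.2 h)
  rw [setIntegral_eq_integral_of_forall_compl_eq_zero (fun x hx => by simp [hψ0 x hx]),
    setIntegral_eq_integral_of_forall_compl_eq_zero (fun x hx => by simp [hχ0 x hx])]
  simp only [gradient_apply]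
  have hc : ∀ {ρ : E d → ℝ}, IsTestFunction U ρ →
      Continuous fun x => fderiv ℝ ρ x (EuclideanSpace.single i 1) := fun hρ =>
    (hρ.1.continuous_fderiv (by simp)).clm_apply continuous_const
  refine integral_mul_fderiv_eq_neg_fderiv_mul_of_integrable ?_ ?_ ?_
    (fun x _ => hψ.differentiable x) (fun x _ => hχ.differentiable x)
  · exact ((hc hψ).mul hχ.1.continuous).integrable_of_hasCompactSupport hχ.2.1.mul_left
  · exact (hψ.1.continuous.mul (hc hχ)).integrable_of_hasCompactSupport hψ.2.1.mul_right
  · exact (hψ.1.continuous.mul hχ.1.continuous).integrable_of_hasCompactSupport hψ.2.1.mul_right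

/-- For approximating test functions the identity is integration by parts. Both sides are `L²` inner
products with a fixed function, hence pass to the limit; for this `v_i χ` is written as the inner
product of `v` with `χ e_i`. -/
theorem MemH10.memH1 {p : Fun d} (hp : MemH10 U p) : MemH1 U p := by
  obtain ⟨hp1, hp2, ψ, hψ, hψ1, hψ2⟩ := hp
  refine ⟨hp1, hp2, fun χ hχ i => ?_⟩
  have hi : ∀ v : E d → E d, ∀ x, v x i * χ x =
      inner ℝ (EuclideanSpace.single i (χ x)) (v x) := by
    intro v x
    rw [EuclideanSpace.inner_single_left]
    simp [mul_comm]
  have hχi : MemLp (fun x => EuclideanSpace.single i (χ x) : E d → E d) 2 (volume.restrict U) := by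
    have hsingle : (fun x => EuclideanSpace.single i (χ x) : E d → E d) =
        fun x => χ x • EuclideanSpace.single i (1 : ℝ) := by
      ext x j
      by_cases hj : j = i <;> simp [hj]
    rw [hsingle]
    have hcont : Continuous fun x => χ x • (EuclideanSpace.single i (1 : ℝ) : E d) :=
      hχ.1.continuous.smul continuous_const
    exact (hcont.memLp_of_hasCompactSupport hχ.2.1.smul_right).restrict U
  have hgi : MemLp (fun x => gradient χ x i) 2 (volume.restrict U) := by
    have hcont : Continuous fun x => gradient χ x i :=
      (EuclideanSpace.proj (𝕜 := ℝ) i).continuous.comp hχ.continuous_gradient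
    exact (hcont.memLp_of_hasCompactSupport (hχ.hasCompactSupport_gradient.comp_left
      (g := fun v : E d => v i) rfl)).restrict U
  have h1 := tendsto_integral_inner hgi (fun n => (hψ n).memLp 2 U) hp1 hψ1
  have h2 := tendsto_integral_inner hχi (fun n => (hψ n).memLp_gradient 2 U) hp2 hψ2
  simp only [← hi] at h2
  simp only [RCLike.inner_apply, conj_trivial] at h1
  refine tendsto_nhds_unique h1 (h2.neg.congr fun n => ?_)
  rw [(hψ n).setIntegral_mul_gradient hχ i]

theorem neg_mul_le_of_abs_le {x y z R G : ℝ} (hx : |x| ≤ R) (hz : |z| ≤ G) :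
    -(x * (2 * y * z)) ≤ 1 / 2 * y ^ 2 + 2 * R ^ 2 * G ^ 2 := by
  have h1 : |x * z| ≤ R * G := by
    rw [abs_mul]
    exact mul_le_mul hx hz (abs_nonneg _) ((abs_nonneg _).trans hx)
  have h2 : (x * z) ^ 2 ≤ (R * G) ^ 2 := sq_le_sq' (neg_le_of_abs_le h1) (le_of_abs_le h1)
  nlinarith [sq_nonneg (y + 2 * (x * z))]

/-- The **Poincaré inequality** on bounded sets, in squared form. -/
theorem IsTestFunction.poincare {ψ : E d → ℝ} (hψ : IsTestFunction U ψ) (i : Fin d) {R : ℝ}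
    (hR : ∀ x ∈ U, ‖x‖ ≤ R) :
    ∫ x in U, ψ x ^ 2 ≤ 4 * R ^ 2 * ∫ x in U, ‖gradient ψ x‖ ^ 2 := by
  have hψ0 : ∀ x, x ∉ U → ψ x = 0 := fun x hx =>
    image_eq_zero_of_notMem_tsupport fun h => hx (hψ.2.2 h)
  have hg0 : ∀ x, x ∉ U → gradient ψ x = 0 := fun x hx =>
    gradient_eq_zero_of_notMem_tsupport fun h => hx (hψ.2.2 h)
  rw [setIntegral_eq_integral_of_forall_compl_eq_zero (fun x hx => by simp [hψ0 x hx]),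
    setIntegral_eq_integral_of_forall_compl_eq_zero (fun x hx => by simp [hg0 x hx])]
  have hψc := hψ.1.continuous
  have hgc := hψ.continuous_gradient
  have hgic : Continuous fun x => gradient ψ x i :=
    (EuclideanSpace.proj (𝕜 := ℝ) i).continuous.comp hgc
  have hxc : Continuous fun x : E d => x i := (EuclideanSpace.proj (𝕜 := ℝ) i).continuous
  have hcoord : ∀ x : E d, fderiv ℝ (fun y : E d => y i) x (EuclideanSpace.single i 1) = 1 := by
    intro x
    have hf : HasFDerivAt (fun y : E d => y i) (EuclideanSpace.proj (𝕜 := ℝ) i) x :=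
      (EuclideanSpace.proj (𝕜 := ℝ) i : E d →L[ℝ] ℝ).hasFDerivAt
    rw [hf.fderiv]
    simp
  have hsq : ∀ x, fderiv ℝ (fun y => ψ y ^ 2) x (EuclideanSpace.single i 1) =
      2 * ψ x * gradient ψ x i := by
    intro x
    rw [((hψ.differentiable x).hasFDerivAt.pow 2).fderiv, gradient_apply]
    simp
  have hψs : HasCompactSupport fun x => ψ x ^ 2 :=
    HasCompactSupport.intro hψ.2.1 fun x hx => by simp [image_eq_zero_of_notMem_tsupport hx]
  have hgs : HasCompactSupport fun x => ‖gradient ψ x‖ ^ 2 :=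
    HasCompactSupport.intro hψ.2.1 fun x hx => by simp [gradient_eq_zero_of_notMem_tsupport hx]
  have i1 : Integrable (fun x => ψ x ^ 2) volume :=
    Continuous.integrable_of_hasCompactSupport (by fun_prop) hψs
  have i2 : Integrable (fun x => ‖gradient ψ x‖ ^ 2) volume :=
    Continuous.integrable_of_hasCompactSupport (by fun_prop) hgs
  have i3 : Integrable (fun x : E d => x i * (2 * ψ x * gradient ψ x i)) volume :=
    Continuous.integrable_of_hasCompactSupport (by fun_prop)
      (HasCompactSupport.intro hψ.2.1 fun x hx => by simp [image_eq_zero_of_notMem_tsupport hx])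
  have i4 : Integrable (fun x : E d => x i * ψ x ^ 2) volume :=
    Continuous.integrable_of_hasCompactSupport (by fun_prop)
      (HasCompactSupport.intro hψ.2.1 fun x hx => by simp [image_eq_zero_of_notMem_tsupport hx])
  -- Since `∂_i x_i = 1`, integration by parts turns `∫ ψ²` into `-∫ x_i ∂_i(ψ²)`, where the factor
  -- `x_i` is bounded by `R` on `U`.
  have hparts := integral_mul_fderiv_eq_neg_fderiv_mul_of_integrable (μ := volume)
    (f := fun y : E d => y i) (g := fun y => ψ y ^ 2) (v := EuclideanSpace.single i 1)
    (by simpa only [hcoord, one_mul] using i1) (by simpa only [hsq] using i3) i4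
    (fun x _ => (EuclideanSpace.proj (𝕜 := ℝ) i : E d →L[ℝ] ℝ).differentiableAt)
    (fun x _ => (hψ.differentiable x).pow 2)
  simp only [hcoord, hsq, one_mul] at hparts
  -- Young's inequality leaves half of `∫ ψ²` on the right; absorbing it doubles `2 R²` to `4 R²`.
  have hle : -∫ x : E d, x i * (2 * ψ x * gradient ψ x i) ≤
      ∫ x, (1 / 2 * ψ x ^ 2 + 2 * R ^ 2 * ‖gradient ψ x‖ ^ 2) := by
    rw [← integral_neg]
    refine integral_mono i3.neg ((i1.const_mul _).add (i2.const_mul _)) fun x => ?_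
    by_cases hx : x ∈ U
    · exact neg_mul_le_of_abs_le ((PiLp.norm_apply_le x i).trans (hR x hx))
        (PiLp.norm_apply_le (gradient ψ x) i)
    · simp [hψ0 x hx, hg0 x hx]
  rw [integral_add (i1.const_mul _) (i2.const_mul _), integral_const_mul,
    integral_const_mul] at hle
  linarith

/-! ### Solvability of the weak Dirichlet problem. -/

theorem norm_toLp_sq {α F : Type*} [MeasurableSpace α] {μ : Measure α} [NormedAddCommGroup F]
    [InnerProductSpace ℝ F] {f : α → F} (hf : MemLp f 2 μ) :
    ‖hf.toLp f‖ ^ 2 = ∫ x, ‖f x‖ ^ 2 ∂μ := by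
  rw [← real_inner_self_eq_norm_sq, inner_toLp]
  simp only [real_inner_self_eq_norm_sq]

/-- The gradients of test functions, weighted by `ρ`, as a subspace of `L²(U)`. -/
def weightedGradients (U : Set (E d)) (ρ : E d → ℝ) :
    Submodule ℝ (Lp (E d) 2 (volume.restrict U)) where
  carrier := {g | ∃ ψ, IsTestFunction U ψ ∧ g =ᵐ[volume.restrict U] fun x => ρ x • gradient ψ x}
  add_mem' := by
    rintro a b ⟨ψ, hψ, ha⟩ ⟨χ, hχ, hb⟩
    refine ⟨ψ + χ, hψ.add hχ, ?_⟩
    filter_upwards [ha, hb, Lp.coeFn_add a b] with x h1 h2 h3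
    rw [h3, Pi.add_apply, h1, h2, hψ.gradient_add hχ, Pi.add_apply, smul_add]
  zero_mem' := by
    refine ⟨0, isTestFunction_zero, ?_⟩
    filter_upwards [Lp.coeFn_zero (E d) 2 (volume.restrict U)] with x hx
    rw [hx]
    simp [gradient_eq_toDual_symm]
  smul_mem' := by
    rintro c a ⟨ψ, hψ, ha⟩
    refine ⟨c • ψ, hψ.smul c, ?_⟩
    filter_upwards [ha, Lp.coeFn_smul c a] with x h1 h2
    rw [h2, Pi.smul_apply, h1, hψ.gradient_smul c, Pi.smul_apply, smul_comm]

/-- If the gradients of test functions converge in `L²` on a bounded set, then the limit is the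
gradient of a member of `H₀¹`. -/
theorem exists_memH10_of_tendsto_gradient (i : Fin d) (hU : Bornology.IsBounded U)
    {ψ : ℕ → E d → ℝ} (hψ : ∀ n, IsTestFunction U (ψ n)) {g : E d → E d}
    (hg : MemLp g 2 (volume.restrict U))
    (h : Tendsto (fun n => eLpNorm (fun x => g x - gradient (ψ n) x) 2 (volume.restrict U))
      atTop (𝓝 0)) :
    ∃ p : E d → ℝ, MemH10 U (p, g) := by
  obtain ⟨R, hR⟩ := hU.exists_norm_le
  have hcau := ((tendsto_toLp_iff (fun n => (hψ n).memLp_gradient 2 U) hg).2 h).cauchySeq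
  -- The Poincaré inequality for `ψ a - ψ b`: convergence of the gradients forces the functions to
  -- be Cauchy in `L²`. The absolute value is needed because `R` may be negative when `U` is empty.
  have hle : ∀ a b, dist (((hψ a).memLp 2 U).toLp (ψ a)) (((hψ b).memLp 2 U).toLp (ψ b)) ≤
      2 * |R| * dist (((hψ a).memLp_gradient 2 U).toLp _) (((hψ b).memLp_gradient 2 U).toLp _) := by
    intro a b
    have hab : IsTestFunction U (ψ a + (-1 : ℝ) • ψ b) := (hψ a).add ((hψ b).smul (-1))
    have hgr : gradient (ψ a + (-1 : ℝ) • ψ b) = gradient (ψ a) - gradient (ψ b) := by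
      rw [(hψ a).gradient_add ((hψ b).smul (-1)), (hψ b).gradient_smul (-1)]
      simp [sub_eq_add_neg]
    have hp := hab.poincare i hR
    rw [dist_eq_norm, dist_eq_norm, ← MemLp.toLp_sub, ← MemLp.toLp_sub]
    refine abs_le_of_sq_le_sq' ?_ (by positivity) |>.2
    rw [mul_pow, norm_toLp_sq, norm_toLp_sq, mul_pow, sq_abs]
    rw [hgr] at hp
    simp only [Pi.sub_apply, Real.norm_eq_abs, sq_abs]
    simp only [Pi.add_apply, Pi.sub_apply, Pi.smul_apply, smul_eq_mul, neg_one_mul,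
      ← sub_eq_add_neg] at hp
    linarith
  have hcau' : CauchySeq fun n => ((hψ n).memLp 2 U).toLp (ψ n) := by
    rw [cauchySeq_iff_tendsto_dist_atTop_0] at hcau ⊢
    refine squeeze_zero (fun _ => dist_nonneg) (fun n => hle n.1 n.2) ?_
    simpa using hcau.const_mul (2 * |R|)
  obtain ⟨p, hp⟩ := cauchySeq_tendsto_of_complete hcau'
  have hpm : MemLp p 2 (volume.restrict U) := Lp.memLp p
  refine ⟨p, hpm, hg, ψ, hψ, ?_, h⟩
  rw [← tendsto_toLp_iff (fun n => (hψ n).memLp 2 U) hpm]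
  simpa only [Lp.toLp_coeFn] using hp

/-- Solvability of the weak Dirichlet problem `-∇·(κ∇p) = -∇·G` in `H₀¹(U)`. -/
theorem exists_dirichlet_solution (i : Fin d) (hU : Bornology.IsBounded U) {κ : E d → ℝ}
    (hκ : MemLp κ ⊤ (volume.restrict U)) {a : ℝ} (ha : 0 < a)
    (hκa : ∀ᵐ x ∂(volume.restrict U), a ≤ κ x) {G : E d → E d}
    (hG : MemLp G 2 (volume.restrict U)) :
    ∃ p, MemH10 U p ∧ ∀ w, MemH10 U w →
      form κ U p w = ∫ x in U, inner ℝ (G x) (w.2 x) := by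
  set μ := volume.restrict U
  have hρ := memLp_top_sqrt hκ
  have hσ : MemLp (fun x => (√(κ x))⁻¹) ⊤ μ := by
    refine memLp_top_of_bound (hρ.1.aemeasurable.inv.aestronglyMeasurable) (√a)⁻¹ ?_
    filter_upwards [hκa] with x hx
    rw [Real.norm_of_nonneg (inv_nonneg.2 (Real.sqrt_nonneg _))]
    exact inv_anti₀ (Real.sqrt_pos.2 ha) (Real.sqrt_le_sqrt hx)
  have hG' : MemLp (fun x => (√(κ x))⁻¹ • G x) 2 μ := hG.smul hσ
  let S := (weightedGradients U fun x => √(κ x)).topologicalClosure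
  have : CompleteSpace S := (Submodule.isClosed_topologicalClosure _).completeSpace_coe
  -- In the variable `√κ ∇p` the equation says that `κ^(-1/2) G - √κ ∇p` is orthogonal to all
  -- weighted gradients, so `√κ ∇p` must be the orthogonal projection of `κ^(-1/2) G`. The lower
  -- bound on `κ` lets the weight be divided out again.
  set g : Lp (E d) 2 μ := S.starProjection (hG'.toLp _) with hgdef
  have hgS : g ∈ S := Submodule.starProjection_apply_mem _ _
  have hgm : MemLp g 2 μ := Lp.memLp g
  obtain ⟨γ, hγS, hγ⟩ := mem_closure_iff_seq_limit.1 hgS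
  choose ψ hψ hγψ using hγS
  have hρψ : ∀ n, MemLp (fun x => √(κ x) • gradient (ψ n) x) 2 μ := fun n =>
    ((hψ n).memLp_gradient 2 U).smul hρ
  have hp2 : MemLp (fun x => (√(κ x))⁻¹ • g x) 2 μ := hgm.smul hσ
  have hlim : Tendsto (fun n => eLpNorm (fun x => g x - √(κ x) • gradient (ψ n) x) 2 μ)
      atTop (𝓝 0) := by
    rw [← tendsto_toLp_iff hρψ hgm, Lp.toLp_coeFn]
    refine hγ.congr fun n => ?_
    rw [← Lp.toLp_coeFn (γ n) (Lp.memLp _)]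
    exact (MemLp.toLp_eq_toLp_iff _ _).2 (hγψ n)
  have hlim' := tendsto_eLpNorm_mul_of_tendsto hσ hρψ hgm hlim
  obtain ⟨p, hp⟩ := exists_memH10_of_tendsto_gradient i hU hψ hp2 (hlim'.congr fun n => by
    refine eLpNorm_congr_ae ?_
    filter_upwards [hκa] with x hx
    rw [inv_smul_smul₀ (Real.sqrt_pos.2 (ha.trans_le hx)).ne'])
  refine ⟨_, hp, fun w hw => ?_⟩
  obtain ⟨hw1, hw2, χ, hχ, -, hχ2⟩ := hw
  have hρw : MemLp (fun x => √(κ x) • w.2 x) 2 μ := hw2.smul hρ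
  have hρχ : ∀ n, MemLp (fun x => √(κ x) • gradient (χ n) x) 2 μ := fun n =>
    ((hχ n).memLp_gradient 2 U).smul hρ
  have hχlim := (tendsto_toLp_iff hρχ hρw).2
    (tendsto_eLpNorm_mul_of_tendsto hρ (fun n => (hχ n).memLp_gradient 2 U) hw2 hχ2)
  -- Only test gradients lie in the subspace by definition; those of general `w` in `H₀¹(U)` lie in
  -- its closure by approximation.
  have hwS : hρw.toLp _ ∈ S := by
    refine mem_closure_of_tendsto hχlim (Eventually.of_forall fun n => ?_)
    exact ⟨χ n, hχ n, (hρχ n).coeFn_toLp⟩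
  have horth : inner ℝ (hG'.toLp _ - g) (hρw.toLp _) = 0 :=
    (Submodule.sub_starProjection_mem_orthogonal (K := S) (hG'.toLp _)) |> fun h =>
      Submodule.inner_left_of_mem_orthogonal hwS h
  rw [inner_sub_left, sub_eq_zero, inner_toLp, ← Lp.toLp_coeFn g hgm, inner_toLp] at horth
  calc form κ U (p, fun x => (√(κ x))⁻¹ • g x) w
      = ∫ x in U, inner ℝ (g x) (√(κ x) • w.2 x) := by
        refine integral_congr_ae ?_
        filter_upwards [hκa] with x hx
        have h0 := ha.trans_le hx
        have hs := (Real.sqrt_pos.2 h0).ne'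
        simp only [real_inner_smul_left, real_inner_smul_right, ← mul_assoc]
        congr 1
        rw [← div_eq_mul_inv, Real.div_sqrt]
    _ = ∫ x in U, inner ℝ ((√(κ x))⁻¹ • G x) (√(κ x) • w.2 x) := horth.symm
    _ = _ := by
        refine integral_congr_ae ?_
        filter_upwards [hκa] with x hx
        have hs := (Real.sqrt_pos.2 (ha.trans_le hx)).ne'
        simp only [real_inner_smul_left, real_inner_smul_right]
        field_simp

/-- Solvability of `-∇·(κ∇p) = -∇·(κ'∇q)` in `H₀¹(U)`. -/
theorem exists_form_eq (i : Fin d) (hU : Bornology.IsBounded U) {κ κ' : E d → ℝ}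
    (hκ : MemLp κ ⊤ (volume.restrict U)) {a : ℝ} (ha : 0 < a)
    (hκa : ∀ᵐ x ∂(volume.restrict U), a ≤ κ x) (hκ' : MemLp κ' ⊤ (volume.restrict U))
    {q : Fun d} (hq : MemLp q.2 2 (volume.restrict U)) :
    ∃ p, MemH10 U p ∧ ∀ w, MemH10 U w → form κ U p w = form κ' U q w := by
  obtain ⟨p, hp, h⟩ := exists_dirichlet_solution i hU hκ ha hκa (G := κ' • q.2) (hq.smul hκ')
  refine ⟨p, hp, fun w hw => (h w hw).trans ?_⟩
  simp only [form, Pi.smul_apply', real_inner_smul_left]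

end

/-! ## The space `H¹` -/

section

variable {U : Set (E d)}

theorem IsTestFunction.memLp_gradient_apply {χ : E d → ℝ} (hχ : IsTestFunction U χ) (i : Fin d) :
    MemLp (fun x => gradient χ x i) 2 (volume.restrict U) :=
  (EuclideanSpace.proj (𝕜 := ℝ) i).comp_memLp' (hχ.memLp_gradient 2 U)

theorem MemH1.add {p q : Fun d} (hp : MemH1 U p) (hq : MemH1 U q) : MemH1 U (p + q) := by
  refine ⟨hp.1.add hq.1, hp.2.1.add hq.2.1, fun χ hχ i => ?_⟩
  have h1 := hχ.memLp_gradient_apply i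
  have h2 := hχ.memLp 2 U
  have hi : ∀ {v : E d → E d}, MemLp v 2 (volume.restrict U) →
      MemLp (fun x => v x i) 2 (volume.restrict U) := fun hv =>
    (EuclideanSpace.proj (𝕜 := ℝ) i).comp_memLp' hv
  simp only [Prod.fst_add, Prod.snd_add, Pi.add_apply, PiLp.add_apply, add_mul]
  have e1 := integral_add (hp.1.integrable_mul h1) (hq.1.integrable_mul h1)
  have e2 := integral_add ((hi hp.2.1).integrable_mul h2) ((hi hq.2.1).integrable_mul h2)
  simp only [Pi.mul_apply] at e1 e2
  rw [e1, e2, hp.2.2 χ hχ i, hq.2.2 χ hχ i, neg_add]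

theorem MemH1.smul {p : Fun d} (c : ℝ) (hp : MemH1 U p) : MemH1 U (c • p) := by
  refine ⟨hp.1.const_smul c, hp.2.1.const_smul c, fun χ hχ i => ?_⟩
  simp only [Prod.smul_fst, Prod.smul_snd, Pi.smul_apply, PiLp.smul_apply, smul_eq_mul, mul_assoc]
  rw [integral_const_mul, integral_const_mul, hp.2.2 χ hχ i, mul_neg]

theorem MemH1.sub {p q : Fun d} (hp : MemH1 U p) (hq : MemH1 U q) : MemH1 U (p - q) := by
  simpa [sub_eq_add_neg] using hp.add (hq.smul (-1))

end

/-! ## The local basis functions -/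

section

variable {K : Set (E d)} {k k₀ k₁ : E d → ℝ}

/-- The pairs `(l, φ)` of boundary data and the corresponding standard basis function. -/
def stdBasisRelation (hk : MemLp k ⊤ (volume.restrict K)) : Submodule ℝ (Fun d × Fun d) where
  carrier := {q | MemLp q.1.2 2 (volume.restrict K) ∧ IsStdBasis k K q.1 q.2}
  add_mem' := by
    rintro ⟨l, φ⟩ ⟨l', φ'⟩ ⟨hl, h1, h2, h3⟩ ⟨hl', h1', h2', h3'⟩
    refine ⟨hl.add hl', h1.add h1', ?_, fun w hw => ?_⟩
    · simpa only [Prod.mk_add_mk, add_sub_add_comm] using h2.add h2'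
    · change form k K (φ + φ') w = 0
      rw [form_add_left hk h1.2.1 h1'.2.1 hw.2.1, h3 w hw, h3' w hw, add_zero]
  zero_mem' :=
    ⟨MemLp.zero, memH10_zero.memH1, by simpa using memH10_zero, fun w _ => form_zero_left k K w⟩
  smul_mem' := by
    rintro c ⟨l, φ⟩ ⟨hl, h1, h2, h3⟩
    refine ⟨hl.const_smul c, h1.smul c, ?_, fun w hw => ?_⟩
    · simpa only [Prod.smul_mk, smul_sub] using h2.smul c
    · change form k K (c • φ) w = 0
      rw [form_smul_left, h3 w hw, mul_zero]

/-- The pairs `(l, φ)` of boundary data and the corresponding new basis function. -/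
def newBasisRelation (h₀ : MemLp k₀ ⊤ (volume.restrict K)) (h₁ : MemLp k₁ ⊤ (volume.restrict K))
    (J : ℕ) : Submodule ℝ (Fun d × Fun d) where
  -- Square integrability of the data's gradient is part of the relation, since additivity of the
  -- forms in the data requires integrable integrands.
  carrier := {q | MemLp q.1.2 2 (volume.restrict K) ∧ IsNewBasis k₀ k₁ J K q.1 q.2}
  add_mem' := by
    rintro ⟨l, φ⟩ ⟨l', φ'⟩ ⟨hl, p, ξ, hp, hξ0, hξ, hφ⟩ ⟨hl', p', ξ', hp', hξ0', hξ', hφ'⟩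
    refine ⟨hl.add hl', p + p', ξ + ξ', ⟨hp.1.add hp'.1, fun w hw => ?_⟩,
      ⟨hξ0.1.add hξ0'.1, fun w hw => ?_⟩, fun j => ⟨(hξ j).1.add (hξ' j).1, fun w hw => ?_⟩, ?_⟩
    · change form k₀ K (p + p') w = form k₀ K (l + l') w
      rw [form_add_left h₀ hp.1.2.1 hp'.1.2.1 hw.2.1, form_add_left h₀ hl hl' hw.2.1, hp.2 w hw,
        hp'.2 w hw]
    · change form k₀ K (ξ 0 + ξ' 0) w = form k₁ K (p + p' - (l + l')) w
      rw [form_add_left h₀ hξ0.1.2.1 hξ0'.1.2.1 hw.2.1, add_sub_add_comm,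
        form_add_left h₁ (hp.1.2.1.sub hl) (hp'.1.2.1.sub hl') hw.2.1, hξ0.2 w hw, hξ0'.2 w hw]
    · have hm : ∀ j, MemLp (ξ j).2 2 (volume.restrict K) ∧ MemLp (ξ' j).2 2 (volume.restrict K) :=
        fun j => match j with
          | 0 => ⟨hξ0.1.2.1, hξ0'.1.2.1⟩
          | j + 1 => ⟨(hξ j).1.2.1, (hξ' j).1.2.1⟩
      change form k₀ K (ξ (j + 1) + ξ' (j + 1)) w = -form k₁ K (ξ j + ξ' j) w
      rw [form_add_left h₀ (hξ j).1.2.1 (hξ' j).1.2.1 hw.2.1,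
        form_add_left h₁ (hm j).1 (hm j).2 hw.2.1, (hξ j).2 w hw, (hξ' j).2 w hw, neg_add]
    · change φ + φ' = l + l' - (p + p') + ∑ j ∈ Finset.range (J + 1), (ξ j + ξ' j)
      dsimp only at hφ hφ'
      rw [hφ, hφ', Finset.sum_add_distrib]
      abel
  zero_mem' := by
    refine ⟨MemLp.zero, 0, 0, ⟨memH10_zero, fun w _ => rfl⟩, ⟨memH10_zero, fun w _ => ?_⟩,
      fun j => ⟨memH10_zero, fun w _ => ?_⟩, by simp⟩ <;> simp [form_zero_left]
  smul_mem' := by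
    rintro c ⟨l, φ⟩ ⟨hl, p, ξ, hp, hξ0, hξ, hφ⟩
    refine ⟨hl.const_smul c, c • p, c • ξ, ⟨hp.1.smul c, fun w hw => ?_⟩,
      ⟨hξ0.1.smul c, fun w hw => ?_⟩, fun j => ⟨(hξ j).1.smul c, fun w hw => ?_⟩, ?_⟩
    · change form k₀ K (c • p) w = form k₀ K (c • l) w
      rw [form_smul_left, form_smul_left, hp.2 w hw]
    · change form k₀ K (c • ξ 0) w = form k₁ K (c • p - c • l) w
      rw [← smul_sub, form_smul_left, form_smul_left, hξ0.2 w hw]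
    · change form k₀ K (c • ξ (j + 1)) w = -form k₁ K (c • ξ j) w
      rw [form_smul_left, form_smul_left, (hξ j).2 w hw, mul_neg]
    · change c • φ = c • l - c • p + ∑ j ∈ Finset.range (J + 1), c • ξ j
      dsimp only at hφ
      rw [hφ, smul_add, smul_sub, Finset.smul_sum]

/-- Two linear relations with the same data: an element of the span of the values of the first
relation has a counterpart, for the same data, in the span of the values of the second. -/
theorem exists_mem_span_of_relations {X ν : Type*} [AddCommGroup X] [Module ℝ X]
    (R R' : Submodule ℝ (X × X)) (l : ν → X) (h : ∀ i, ∃ φ, (l i, φ) ∈ R') {w : X}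
    (hw : w ∈ Submodule.span ℝ {φ | ∃ i, (l i, φ) ∈ R}) :
    ∃ L, ∃ w' ∈ Submodule.span ℝ {φ | ∃ i, (l i, φ) ∈ R'}, (L, w) ∈ R ∧ (L, w') ∈ R' := by
  induction hw using Submodule.span_induction with
  | mem φ hφ =>
    obtain ⟨i, hi⟩ := hφ
    obtain ⟨φ', hφ'⟩ := h i
    exact ⟨l i, φ', Submodule.subset_span ⟨i, hφ'⟩, hi, hφ'⟩
  | zero => exact ⟨0, 0, zero_mem _, zero_mem _, zero_mem _⟩
  | add x y _ _ hx hy =>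
    obtain ⟨L, x', hx', h1, h2⟩ := hx
    obtain ⟨L', y', hy', h1', h2'⟩ := hy
    exact ⟨L + L', x' + y', add_mem hx' hy', add_mem h1 h1', add_mem h2 h2'⟩
  | smul c x _ hx =>
    obtain ⟨L, x', hx', h1, h2⟩ := hx
    exact ⟨c • L, c • x', Submodule.smul_mem _ c hx', Submodule.smul_mem _ c h1,
      Submodule.smul_mem _ c h2⟩

/-- A coefficient `k` and an approximation `k₀` of it on `U`, both bounded from above and bounded
away from zero, with relative error at most `η`. -/
structure IsSplitting (k k₀ : E d → ℝ) (η : ℝ) (U : Set (E d)) : Prop where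
  memLp : MemLp k ⊤ (volume.restrict U)
  memLp₀ : MemLp k₀ ⊤ (volume.restrict U)
  lower : ∃ a : ℝ, 0 < a ∧ ∀ᵐ x ∂(volume.restrict U), a ≤ k x ∧ a ≤ k₀ x
  nonneg : 0 ≤ η
  abs_sub_le : ∀ᵐ x ∂(volume.restrict U), |k x - k₀ x| ≤ η * k₀ x

namespace IsSplitting

variable {η : ℝ} {U : Set (E d)}

protected theorem mono (h : IsSplitting k k₀ η U) (hKU : K ⊆ U) : IsSplitting k k₀ η K := by
  have hle : volume.restrict K ≤ volume.restrict U := Measure.restrict_mono_set _ hKU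
  obtain ⟨a, ha, h'⟩ := h.lower
  exact ⟨h.memLp.mono_measure hle, h.memLp₀.mono_measure hle,
    ⟨a, ha, ae_mono hle h'⟩, h.nonneg, ae_mono hle h.abs_sub_le⟩

theorem memLp₁ (h : IsSplitting k k₀ η U) :
    MemLp (fun x => k x - k₀ x) ⊤ (volume.restrict U) :=
  h.memLp.sub h.memLp₀

theorem pos₀ (h : IsSplitting k k₀ η U) : ∀ᵐ x ∂(volume.restrict U), 0 ≤ k₀ x := by
  obtain ⟨a, ha, h'⟩ := h.lower
  filter_upwards [h'] with x hx using ha.le.trans hx.2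

theorem pos (h : IsSplitting k k₀ η U) : ∀ᵐ x ∂(volume.restrict U), 0 ≤ k x := by
  obtain ⟨a, ha, h'⟩ := h.lower
  filter_upwards [h'] with x hx using ha.le.trans hx.1

end IsSplitting

/-- Subtracting from `l` its `k`-elliptic projection to `H₀¹(K)` leaves a `k`-harmonic function with
the same boundary data. -/
theorem exists_isStdBasis (i : Fin d) (hK : Bornology.IsBounded K) {η : ℝ}
    (h : IsSplitting k k₀ η K) {l : Fun d} (hl : MemH1 K l) : ∃ φ, IsStdBasis k K l φ := by
  obtain ⟨a, ha, h'⟩ := h.lower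
  obtain ⟨p, hp, hpw⟩ := exists_form_eq i hK h.memLp ha (h'.mono fun _ hx => hx.1) h.memLp hl.2.1
  refine ⟨l - p, hl.sub hp.memH1, by simpa using hp.neg, fun w hw => ?_⟩
  rw [form_sub_left h.memLp hl.2.1 hp.2.1 hw.2.1, hpw w hw, sub_self]

theorem exists_isNewBasis (i : Fin d) (hK : Bornology.IsBounded K) {η : ℝ}
    (h : IsSplitting k k₀ η K) (J : ℕ) {l : Fun d} (hl : MemLp l.2 2 (volume.restrict K)) :
    ∃ φ, IsNewBasis k₀ (fun x => k x - k₀ x) J K l φ := by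
  obtain ⟨a, ha, h'⟩ := h.lower
  have hex : ∀ {κ : E d → ℝ}, MemLp κ ⊤ (volume.restrict K) → ∀ {q : Fun d},
      MemLp q.2 2 (volume.restrict K) →
      ∃ p, MemH10 K p ∧ ∀ w, MemH10 K w → form k₀ K p w = form κ K q w := fun hκ _ hq =>
    exists_form_eq i hK h.memLp₀ ha (h'.mono fun _ hx => hx.2) hκ hq
  obtain ⟨p, hp⟩ := hex h.memLp₀ hl
  obtain ⟨ξ0, hξ0⟩ := hex h.memLp₁ (q := p - l) (hp.1.2.1.sub hl)
  -- One bubble step as a map on the subtype of `H₀¹(K)`, so that a chosen solution operator can be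
  -- iterated to produce the whole sequence.
  have hstep : ∀ q : {q : Fun d // MemH10 K q}, ∃ p : {q : Fun d // MemH10 K q},
      ∀ w, MemH10 K w → form k₀ K p w = -form (fun x => k x - k₀ x) K q w := by
    rintro ⟨q, hq⟩
    obtain ⟨p, hp, hpw⟩ := hex h.memLp₁ (q := -q) hq.neg.2.1
    exact ⟨⟨p, hp⟩, fun w hw => by rw [hpw w hw, form_neg_left]⟩
  choose T hT using hstep
  refine ⟨_, p, fun j => (T^[j] ⟨ξ0, hξ0.1⟩ : {q : Fun d // MemH10 K q}), hp, hξ0,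
    fun j => ⟨Subtype.property _, fun w hw => ?_⟩, rfl⟩
  simp only [Function.iterate_succ_apply']
  exact hT _ w hw

theorem form_neg_neg (κ : E d → ℝ) (U : Set (E d)) (p : Fun d) :
    form κ U (-p) (-p) = form κ U p p := by
  rw [form_neg_left, form_comm, form_neg_left, neg_neg]

/-- The new basis function differs from the standard one by a bubble function whose `k₀`-energy
is geometrically small in `J`. -/
theorem IsNewBasis.sub_isStdBasis {η : ℝ} (h : IsSplitting k k₀ η K) {J : ℕ} {l φ ψ : Fun d}
    (hl : MemLp l.2 2 (volume.restrict K))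
    (hψ : IsNewBasis k₀ (fun x => k x - k₀ x) J K l ψ) (hφ : IsStdBasis k K l φ) :
    MemH10 K (ψ - φ) ∧
      form k₀ K (ψ - φ) (ψ - φ) ≤ (η ^ (J + 1)) ^ 2 * form k₀ K φ φ := by
  obtain ⟨p, ξ, hp, hξ0, hξ, rfl⟩ := hψ
  obtain ⟨hφ1, hφl, hφw⟩ := hφ
  have hm : ∀ j, MemH10 K (ξ j) := fun j => match j with
    | 0 => hξ0.1
    | j + 1 => (hξ j).1
  -- The error after `n` bubbles. The new basis function sums over `j ≤ J`, so its error is `ρ (J +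
  -- 1)`, whence the exponent.
  set ρ : ℕ → Fun d := fun n => φ - l + p - ∑ j ∈ Finset.range n, ξ j with hρdef
  have hρ : ∀ n, MemH10 K (ρ n) := fun n => (hφl.add hp.1).sub (MemH10.sum _ hm)
  have hsucc : ∀ n, ρ (n + 1) = ρ n - ξ n := fun n => by
    simp only [hρdef, Finset.sum_range_succ]
    abel
  -- The error recursion. The base case is where the equation of `φ` enters: `k`-harmonicity says
  -- `(k₁∇φ, ∇w) = -(k₀∇φ, ∇w)`. Later steps only subtract the bubble equations.
  have hform : ∀ n, ∀ w, MemH10 K w →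
      form k₀ K (ρ (n + 1)) w = form (fun x => k x - k₀ x) K (-ρ n) w := by
    intro n w hw
    induction n with
    | zero =>
      have h0 : ρ 0 = φ - (l - p) := by
        simp only [hρdef, Finset.range_zero, Finset.sum_empty, sub_zero]
        abel
      have h1 : p - l = -(l - p) := by abel
      rw [hsucc, form_sub_left h.memLp₀ (hρ 0).2.1 hξ0.1.2.1 hw.2.1, hξ0.2 w hw, h0, h1,
        form_neg_left, form_neg_left, form_sub_left h.memLp₀ hφ1.2.1 (hl.sub hp.1.2.1) hw.2.1,
        form_sub_left h.memLp₀ hl hp.1.2.1 hw.2.1, hp.2 w hw,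
        form_sub_left h.memLp₁ hφ1.2.1 (hl.sub hp.1.2.1) hw.2.1]
      have := form_sub_coeff h.memLp h.memLp₀ hφ1.2.1 hw.2.1
      rw [hφw w hw] at this
      linarith
    | succ n ih =>
      rw [hsucc (n + 1), form_sub_left h.memLp₀ (hρ _).2.1 (hξ n).1.2.1 hw.2.1, ih,
        (hξ n).2 w hw, hsucc n, form_neg_left, form_neg_left,
        form_sub_left h.memLp₁ (hρ n).2.1 (hm n).2.1 hw.2.1]
      ring
  have hbound : ∀ n, form k₀ K (ρ n) (ρ n) ≤ (η ^ n) ^ 2 * form k₀ K φ φ := by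
    intro n
    induction n with
    | zero =>
      have h0 : ρ 0 = φ - (l - p) := by
        simp only [hρdef, Finset.range_zero, Finset.sum_empty, sub_zero]
        abel
      -- Since `l - p` is `k₀`-orthogonal to `H₀¹(K)`, `ρ 0` is the `k₀`-projection of `φ`; the
      -- energy bound with `η = 1` and equal coefficients says that projecting does not increase
      -- energy.
      have heq : form k₀ K (ρ 0) (ρ 0) = form k₀ K φ (ρ 0) := by
        have h1 : form k₀ K (ρ 0) (ρ 0) = form k₀ K (φ - (l - p)) (ρ 0) := by rw [← h0]
        rw [h1, form_sub_left h.memLp₀ hφ1.2.1 (hl.sub hp.1.2.1) (hρ 0).2.1,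
          form_sub_left h.memLp₀ hl hp.1.2.1 (hρ 0).2.1, hp.2 _ (hρ 0), sub_self, sub_zero]
      have := form_self_le_of_form_self_eq zero_le_one h.memLp₀ h.memLp₀
        (h.pos₀.mono fun x hx => by rw [abs_of_nonneg hx, one_mul]) h.pos₀ (hρ 0).2.1 hφ1.2.1 heq
      simpa using this
    | succ n ih =>
      have := form_self_le_of_form_self_eq h.nonneg h.memLp₀ h.memLp₁ h.abs_sub_le h.pos₀
        (hρ (n + 1)).2.1 (hρ n).neg.2.1 (hform n _ (hρ (n + 1)))
      rw [form_neg_neg] at this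
      calc _ ≤ _ := this
        _ ≤ η ^ 2 * ((η ^ n) ^ 2 * form k₀ K φ φ) := mul_le_mul_of_nonneg_left ih (sq_nonneg η)
        _ = _ := by ring
  have hdiff : l - p + ∑ j ∈ Finset.range (J + 1), ξ j - φ = -ρ (J + 1) := by
    simp only [hρdef]
    abel
  rw [hdiff, form_neg_neg]
  exact ⟨(hρ _).neg, hbound _⟩

end

/-! ## Functions on the partition -/

section

variable {ι : Type*} {D : Set (E d)} {cell : ι → Set (E d)}

theorem form_eq_sum [Fintype ι] (hcell : IsPartition D cell) {κ : E d → ℝ} {p q : Fun d}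
    (hκ : MemLp κ ⊤ (volume.restrict D)) (hp : MemLp p.2 2 (volume.restrict D))
    (hq : MemLp q.2 2 (volume.restrict D)) : form κ D p q = ∑ j, form κ (cell j) p q := by
  have hU : (⋃ j, cell j) ⊆ D := Set.iUnion_subset hcell.subset
  have hae : (D : Set (E d)) =ᵐ[volume] ⋃ j, cell j :=
    (ae_le_set.2 hcell.cover).antisymm hU.eventuallyLE
  rw [form, Measure.restrict_congr_set hae,
    integral_iUnion_fintype (fun j => (hcell.isOpen j).measurableSet) (fun i j => hcell.disjoint i j)]
  · rfl
  · intro j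
    exact IntegrableOn.mono_set (integrable_weighted_inner hκ hp hq) (hcell.subset j)

/-- Modifying a member of `H₀¹(D)` on each cell by a member of `H₀¹` of the cell. -/
theorem exists_memH10_modification [Finite ι] (hcell : IsPartition D cell) {v : Fun d}
    (hv : MemH10 D v) {φ ψ : ι → Fun d}
    (hφ : ∀ j, v.1 =ᵐ[volume.restrict (cell j)] (φ j).1 ∧
      v.2 =ᵐ[volume.restrict (cell j)] (φ j).2)
    (hr : ∀ j, MemH10 (cell j) (ψ j - φ j)) :
    ∃ w, MemH10 D w ∧ ∀ j, w.1 =ᵐ[volume.restrict (cell j)] (ψ j).1 ∧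
      w.2 =ᵐ[volume.restrict (cell j)] (ψ j).2 := by
  have := Fintype.ofFinite ι
  have hmeas := fun j => (hcell.isOpen j).measurableSet
  have hsum : ∀ {F : Type} [AddCommGroup F] (g : ι → E d → F) (j : ι), ∀ x ∈ cell j,
      (∑ i, (cell i).indicator (g i)) x = g j x := by
    intro F _ g j x hx
    rw [Finset.sum_apply, Finset.sum_eq_single j]
    · simp [hx]
    · intro i _ hij
      exact Set.indicator_of_notMem (Set.disjoint_right.1 (hcell.disjoint i j hij) hx) _
    · simp
  refine ⟨v + ∑ j, ((cell j).indicator (ψ j - φ j).1, (cell j).indicator (ψ j - φ j).2),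
    hv.add (MemH10.sum _ fun j => (hr j).indicator (hmeas j) (hcell.subset j)), fun j => ⟨?_, ?_⟩⟩
  · filter_upwards [(hφ j).1, ae_restrict_mem (hmeas j)] with x h1 hx
    rw [Prod.fst_add, Prod.fst_sum, Pi.add_apply, hsum (fun i => (ψ i - φ i).1) j x hx, h1]
    simp
  · filter_upwards [(hφ j).2, ae_restrict_mem (hmeas j)] with x h1 hx
    rw [Prod.snd_add, Prod.snd_sum, Pi.add_apply, hsum (fun i => (ψ i - φ i).2) j x hx, h1]
    simp

end

/-! ## Companions in the two finite element spaces -/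

section

variable {ι ν : Type*} {D : Set (E d)} {cell : ι → Set (E d)} {l : ι → ν → Fun d}
  {k k₀ : E d → ℝ} {η : ℝ} {J : ℕ}

/-- `v` and `w` are in `H₀¹(D)` and on every cell they are the standard and the new multiscale
function for the same boundary data. -/
def IsCompanion (D : Set (E d)) (cell : ι → Set (E d)) (k k₀ : E d → ℝ) (J : ℕ)
    (v w : Fun d) : Prop :=
  MemH10 D v ∧ MemH10 D w ∧ ∀ j, ∃ L φ ψ : Fun d, MemLp L.2 2 (volume.restrict (cell j)) ∧
    IsStdBasis k (cell j) L φ ∧ IsNewBasis k₀ (fun x => k x - k₀ x) J (cell j) L ψ ∧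
    v.2 =ᵐ[volume.restrict (cell j)] φ.2 ∧ w.2 =ᵐ[volume.restrict (cell j)] ψ.2

/-- On each cell the boundary data of the local combination are fed into the new construction. The
result differs from `v` by a bubble, so the pieces glue to a member of `H₀¹(D)` without any
condition across cell interfaces. -/
theorem exists_isCompanion_of_mem_stdSpace [Finite ι] (i : Fin d) (hD : Bornology.IsBounded D)
    (hcell : IsPartition D cell) (hl : ∀ j i, MemH1 (cell j) (l j i)) (h : IsSplitting k k₀ η D)
    {v : Fun d} (hv : v ∈ stdSpace D cell l k) :
    ∃ w ∈ newSpace D cell l k₀ (fun x => k x - k₀ x) J, IsCompanion D cell k k₀ J v w := by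
  have hj := fun j => h.mono (hcell.subset j)
  have key : ∀ j, ∃ φ L, ∃ ψ ∈ Submodule.span ℝ
      {ψ | ∃ i, IsNewBasis k₀ (fun x => k x - k₀ x) J (cell j) (l j i) ψ},
      (v.1 =ᵐ[volume.restrict (cell j)] φ.1 ∧ v.2 =ᵐ[volume.restrict (cell j)] φ.2) ∧
      MemLp L.2 2 (volume.restrict (cell j)) ∧ IsStdBasis k (cell j) L φ ∧
      IsNewBasis k₀ (fun x => k x - k₀ x) J (cell j) L ψ := by
    intro j
    obtain ⟨φ, hφ, hvφ⟩ := hv.2 j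
    obtain ⟨L, ψ, hψ, h1, h2⟩ := exists_mem_span_of_relations (stdBasisRelation (hj j).memLp)
      (newBasisRelation (hj j).memLp₀ (hj j).memLp₁ J) (l j)
      -- Solvability is essential here: the span runs over all solutions of the local problems and
      -- would lack elements if one had none.
      (fun i' => (exists_isNewBasis i (hD.subset (hcell.subset j)) (hj j) J (hl j i').2.1).imp
        fun _ hφ => ⟨(hl j i').2.1, hφ⟩)
      (Submodule.span_mono (by rintro φ ⟨i, hi⟩; exact ⟨i, (hl j i).2.1, hi⟩) hφ)
    exact ⟨φ, L, ψ, Submodule.span_mono (by rintro φ ⟨i, hi⟩; exact ⟨i, hi.2⟩) hψ, hvφ, h1.1, h1.2, h2.2⟩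
  choose φ L ψ hψ hvφ hL hstd hnew using key
  obtain ⟨w, hw, hwψ⟩ := exists_memH10_modification hcell hv.1 hvφ fun j =>
    ((hnew j).sub_isStdBasis (hj j) (hL j) (hstd j)).1
  exact ⟨w, ⟨hw, fun j => ⟨ψ j, hψ j, hwψ j⟩⟩, hv.1, hw, fun j =>
    ⟨L j, φ j, ψ j, hL j, hstd j, hnew j, (hvφ j).2, (hwψ j).2⟩⟩

theorem exists_isCompanion_of_mem_newSpace [Finite ι] (i : Fin d) (hD : Bornology.IsBounded D)
    (hcell : IsPartition D cell) (hl : ∀ j i, MemH1 (cell j) (l j i)) (h : IsSplitting k k₀ η D)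
    {w : Fun d} (hw : w ∈ newSpace D cell l k₀ (fun x => k x - k₀ x) J) :
    ∃ v ∈ stdSpace D cell l k, IsCompanion D cell k k₀ J v w := by
  have hj := fun j => h.mono (hcell.subset j)
  have key : ∀ j, ∃ ψ L, ∃ φ ∈ Submodule.span ℝ {φ | ∃ i, IsStdBasis k (cell j) (l j i) φ},
      (w.1 =ᵐ[volume.restrict (cell j)] ψ.1 ∧ w.2 =ᵐ[volume.restrict (cell j)] ψ.2) ∧
      MemLp L.2 2 (volume.restrict (cell j)) ∧ IsStdBasis k (cell j) L φ ∧
      IsNewBasis k₀ (fun x => k x - k₀ x) J (cell j) L ψ := by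
    intro j
    obtain ⟨ψ, hψ, hwψ⟩ := hw.2 j
    obtain ⟨L, φ, hφ, h1, h2⟩ := exists_mem_span_of_relations
      (newBasisRelation (hj j).memLp₀ (hj j).memLp₁ J) (stdBasisRelation (hj j).memLp) (l j)
      (fun i' => (exists_isStdBasis i (hD.subset (hcell.subset j)) (hj j) (hl j i')).imp
        fun _ hφ => ⟨(hl j i').2.1, hφ⟩)
      (Submodule.span_mono (by rintro φ ⟨i, hi⟩; exact ⟨i, (hl j i).2.1, hi⟩) hψ)
    exact ⟨ψ, L, φ, Submodule.span_mono (by rintro φ ⟨i, hi⟩; exact ⟨i, hi.2⟩) hφ, hwψ, h1.1, h2.2, h1.2⟩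
  choose ψ L φ hφ hwψ hL hstd hnew using key
  obtain ⟨v, hv, hvφ⟩ := exists_memH10_modification (ψ := φ) hcell hw.1 hwψ fun j => by
    simpa using ((hnew j).sub_isStdBasis (hj j) (hL j) (hstd j)).1.neg
  exact ⟨v, ⟨hv, fun j => ⟨φ j, hφ j, hvφ j⟩⟩, hv, hw.1, fun j =>
    ⟨L j, φ j, ψ j, hL j, hstd j, hnew j, (hvφ j).2, (hwψ j).2⟩⟩

/-- The local estimate has the same factor on every cell, so it survives summation over the
partition. -/
theorem IsCompanion.form_sub_le [Finite ι] (hcell : IsPartition D cell) (h : IsSplitting k k₀ η D)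
    {v w : Fun d} (hvw : IsCompanion D cell k k₀ J v w) :
    form k₀ D (w - v) (w - v) ≤ (η ^ (J + 1)) ^ 2 * form k₀ D v v := by
  have := Fintype.ofFinite ι
  obtain ⟨hv, hw, hloc⟩ := hvw
  rw [form_eq_sum hcell h.memLp₀ (hw.sub hv).2.1 (hw.sub hv).2.1,
    form_eq_sum hcell h.memLp₀ hv.2.1 hv.2.1, Finset.mul_sum]
  refine Finset.sum_le_sum fun j _ => ?_
  obtain ⟨L, φ, ψ, hL, hφ, hψ, hvφ, hwψ⟩ := hloc j
  have hsub : (w - v).2 =ᵐ[volume.restrict (cell j)] (ψ - φ).2 := hwψ.sub hvφ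
  rw [form_congr hsub hsub, form_congr hvφ hvφ]
  exact (hψ.sub_isStdBasis (h.mono (hcell.subset j)) hL hφ).2

/-- On each cell `y` is `k`-harmonic and `w - v` is a bubble, so every local contribution vanishes.
This is the orthogonality behind the Galerkin comparison. -/
theorem IsCompanion.form_eq_zero [Finite ι] (hcell : IsPartition D cell)
    (hl : ∀ j i, MemH1 (cell j) (l j i)) (h : IsSplitting k k₀ η D)
    {v w : Fun d} (hvw : IsCompanion D cell k k₀ J v w) {y : Fun d}
    (hy : y ∈ stdSpace D cell l k) : form k D y (w - v) = 0 := by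
  have := Fintype.ofFinite ι
  obtain ⟨hv, hw, hloc⟩ := hvw
  rw [form_eq_sum hcell h.memLp hy.1.2.1 (hw.sub hv).2.1]
  refine Finset.sum_eq_zero fun j _ => ?_
  obtain ⟨L, φ, ψ, hL, hφ, hψ, hvφ, hwψ⟩ := hloc j
  have hj := h.mono (hcell.subset j)
  obtain ⟨χ, hχ, -, hyχ⟩ := hy.2 j
  have hsub : (w - v).2 =ᵐ[volume.restrict (cell j)] (ψ - φ).2 := hwψ.sub hvφ
  -- The relation `⊤` makes the second component void: all that is wanted is that a member of the
  -- span is itself a standard function for some data `L'`.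
  have hχ' : ∃ L', ∃ w' ∈ Submodule.span ℝ {φ | ∃ i, (l j i, φ) ∈ (⊤ : Submodule ℝ (Fun d × Fun d))},
      (L', χ) ∈ stdBasisRelation hj.memLp ∧ (L', w') ∈ (⊤ : Submodule ℝ (Fun d × Fun d)) :=
    exists_mem_span_of_relations _ ⊤ (l j) (fun _ => ⟨0, trivial⟩)
      (Submodule.span_mono (by rintro φ ⟨i, hi⟩; exact ⟨i, (hl j i).2.1, hi⟩) hχ)
  obtain ⟨L', -, -, hχL, -⟩ := hχ'
  rw [form_congr hyχ hsub]
  exact hχL.2.2.2 _ (hψ.sub_isStdBasis hj hL hφ).1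

end

/-! ## The energy inner product -/

/-- The functions with square integrable gradient on `U`. -/
def l2Gradients (U : Set (E d)) : Submodule ℝ (Fun d) where
  carrier := {p | MemLp p.2 2 (volume.restrict U)}
  add_mem' hp hq := hp.add hq
  zero_mem' := MemLp.zero
  smul_mem' c _ hp := hp.const_smul c

/-- `form κ U` is the inner product of `√κ ∇p` and `√κ ∇q` in `L²`. -/
theorem exists_energy_map {U : Set (E d)} {κ : E d → ℝ} (hκ : MemLp κ ⊤ (volume.restrict U))
    (h0 : ∀ᵐ x ∂(volume.restrict U), 0 ≤ κ x) :
    ∃ T : l2Gradients U →ₗ[ℝ] Lp (E d) 2 (volume.restrict U),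
      ∀ p q, inner ℝ (T p) (T q) = form κ U p q := by
  have hρ := memLp_top_sqrt hκ
  have hm : ∀ p : l2Gradients U,
      MemLp (fun x => √(κ x) • (p : Fun d).2 x) 2 (volume.restrict U) := fun p => p.2.smul hρ
  refine ⟨⟨⟨fun p => (hm p).toLp _, fun p q => ?_⟩, fun c p => ?_⟩, fun p q => ?_⟩
  · rw [← MemLp.toLp_add]
    congr 1 with x
    simp
  · rw [RingHom.id_apply, ← MemLp.toLp_const_smul]
    refine (MemLp.toLp_eq_toLp_iff (hm (c • p)) ((hm p).const_smul c)).2 (Eventually.of_forall fun x => ?_)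
    exact smul_comm (√(κ x)) c ((p : Fun d).2 x)
  · change inner ℝ ((hm p).toLp _) ((hm q).toLp _) = _
    rw [inner_toLp]
    refine integral_congr_ae ?_
    filter_upwards [h0] with x hx
    rw [real_inner_smul_left, real_inner_smul_right, ← mul_assoc, Real.mul_self_sqrt hx]

/-- The error estimate for two Galerkin projections `uh`, `uJ` of `u` to different spaces, in terms
of corrections `zh`, `zJ` that carry the projections to the other space. -/
theorem norm_sub_sq_le_of_galerkin {H : Type*} [NormedAddCommGroup H] [InnerProductSpace ℝ H]
    {u uh uJ zh zJ : H} {a b : ℝ} (hhh : inner ℝ uh uh = inner ℝ u uh)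
    (hhJ : inner ℝ uh (uJ - zJ) = inner ℝ u (uJ - zJ)) (horth : inner ℝ uh zJ = 0)
    (hJJ : inner ℝ uJ uJ = inner ℝ u uJ) (hJh : inner ℝ uJ (uh + zh) = inner ℝ u (uh + zh))
    (ha : 0 ≤ a) (hb : 0 ≤ b) (hzh : ‖zh‖ ≤ a * ‖uh‖) (hzJ : ‖zJ‖ ≤ b * ‖uJ‖) :
    ‖uh - uJ‖ ^ 2 ≤ (a + b) * ‖u‖ ^ 2 := by
  -- The hypothesis gives `‖x‖² = (u, x) ≤ ‖u‖ ‖x‖`. It applies to the projections `uh` and `uJ`,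
  -- and also to the complement `u - uJ`.
  have hle : ∀ {x : H}, inner ℝ x x = inner ℝ u x → ‖x‖ ≤ ‖u‖ := by
    intro x hx
    rw [real_inner_self_eq_norm_sq] at hx
    nlinarith [real_inner_le_norm u x, norm_nonneg x, norm_nonneg u]
  have hsub : ‖u - uJ‖ ≤ ‖u‖ := by
    refine hle ?_
    simp only [inner_sub_left, inner_sub_right, hJJ, real_inner_comm]
    ring
  -- The mixed product `(uh, uJ)` is computed twice: through `uJ - zJ` with `horth` it is `(u, uJ) -
  -- (u, zJ)`, and through `uh + zh` it is `(u, uh) + (u - uJ, zh)`. Using each once cancels the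
  -- main terms.
  have hid : ‖uh - uJ‖ ^ 2 = -inner ℝ (u - uJ) zh + inner ℝ u zJ := by
    rw [← real_inner_self_eq_norm_sq]
    simp only [inner_sub_left, inner_sub_right, inner_add_right] at *
    rw [real_inner_comm uJ uh] at *
    linarith
  have h1 : -inner ℝ (u - uJ) zh ≤ ‖u‖ * (a * ‖u‖) :=
    (neg_le_abs _).trans ((abs_real_inner_le_norm _ _).trans
      (mul_le_mul hsub (hzh.trans (mul_le_mul_of_nonneg_left (hle hhh) ha)) (norm_nonneg _)
        (norm_nonneg _)))
  have h2 : inner ℝ u zJ ≤ ‖u‖ * (b * ‖u‖) :=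
    (real_inner_le_norm _ _).trans (mul_le_mul_of_nonneg_left
      (hzJ.trans (mul_le_mul_of_nonneg_left (hle hJJ) hb)) (norm_nonneg _))
  rw [hid]
  linarith

/-- The error estimate for a deterministic coefficient. -/
theorem form_sub_le_of_galerkin {ι ν : Type*} [Finite ι] (i : Fin d) {D : Set (E d)}
    (hD : Bornology.IsBounded D) {cell : ι → Set (E d)} (hcell : IsPartition D cell)
    {l : ι → ν → Fun d} (hl : ∀ j i, MemH1 (cell j) (l j i)) {k k₀ : E d → ℝ} {η s : ℝ}
    (h : IsSplitting k k₀ η D) (hη : η < 1) (hs : 0 ≤ s)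
    (hks : ∀ᵐ x ∂(volume.restrict D), k₀ x ≤ s ^ 2 * k x) (J : ℕ) {F : Fun d → ℝ}
    {u uh uJ : Fun d} (hu : MemH10 D u) (hu' : ∀ w, MemH10 D w → form k D u w = F w)
    (huh : uh ∈ stdSpace D cell l k) (huh' : ∀ w ∈ stdSpace D cell l k, form k D uh w = F w)
    (huJ : uJ ∈ newSpace D cell l k₀ (fun x => k x - k₀ x) J)
    (huJ' : ∀ w ∈ newSpace D cell l k₀ (fun x => k x - k₀ x) J, form k D uJ w = F w) :
    form k D (uh - uJ) (uh - uJ) ≤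
      √2 * s * (η ^ (J + 1) + η ^ (J + 1) / (1 - η ^ (J + 1))) * form k D u u := by
  obtain ⟨vh, hvh, hch⟩ := exists_isCompanion_of_mem_stdSpace (J := J) i hD hcell hl h huh
  obtain ⟨vJ, hvJ, hcJ⟩ := exists_isCompanion_of_mem_newSpace i hD hcell hl h huJ
  obtain ⟨T, hT⟩ := exists_energy_map h.memLp h.pos
  obtain ⟨T₀, hT₀⟩ := exists_energy_map h.memLp₀ h.pos₀
  let U : l2Gradients D := ⟨u, hu.2.1⟩
  let Uh : l2Gradients D := ⟨uh, huh.1.2.1⟩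
  let UJ : l2Gradients D := ⟨uJ, huJ.1.2.1⟩
  let Vh : l2Gradients D := ⟨vh, hvh.1.2.1⟩
  let VJ : l2Gradients D := ⟨vJ, hvJ.1.2.1⟩
  set e := η ^ (J + 1) with he
  have he0 : 0 ≤ e := pow_nonneg h.nonneg _
  have he1 : e < 1 := pow_lt_one₀ h.nonneg hη (by omega)
  -- The factor `√2` comes from `k ≤ (1 + η) k₀ ≤ 2 k₀`.
  have hk2 : ∀ p : l2Gradients D, ‖T p‖ ≤ √2 * ‖T₀ p‖ := by
    intro p
    refine (abs_le_of_sq_le_sq' ?_ (by positivity)).2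
    rw [mul_pow, Real.sq_sqrt zero_le_two, ← real_inner_self_eq_norm_sq,
      ← real_inner_self_eq_norm_sq, hT, hT₀]
    refine form_self_le_mul h.memLp h.memLp₀ ?_ p.2
    filter_upwards [h.abs_sub_le, h.pos₀] with x hx hx0
    nlinarith [le_abs_self (k x - k₀ x)]
  have hs2 : ∀ p : l2Gradients D, ‖T₀ p‖ ≤ s * ‖T p‖ := by
    intro p
    refine (abs_le_of_sq_le_sq' ?_ (by positivity)).2
    rw [mul_pow, ← real_inner_self_eq_norm_sq, ← real_inner_self_eq_norm_sq, hT, hT₀]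
    exact form_self_le_mul h.memLp₀ h.memLp hks p.2
  have hcomp : ∀ p q : l2Gradients D, IsCompanion D cell k k₀ J p q →
      ‖T₀ (q - p)‖ ≤ e * ‖T₀ p‖ := by
    intro p q hpq
    refine (abs_le_of_sq_le_sq' ?_ (by positivity)).2
    rw [mul_pow, ← real_inner_self_eq_norm_sq, ← real_inner_self_eq_norm_sq, hT₀, hT₀]
    exact hpq.form_sub_le hcell h
  have hzh : ‖T (Vh - Uh)‖ ≤ √2 * s * e * ‖T Uh‖ := by
    calc ‖T (Vh - Uh)‖ ≤ √2 * (e * ‖T₀ Uh‖) :=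
          (hk2 _).trans (mul_le_mul_of_nonneg_left (hcomp Uh Vh hch) (Real.sqrt_nonneg _))
      _ ≤ √2 * (e * (s * ‖T Uh‖)) := by gcongr; exact hs2 _
      _ = _ := by ring
  -- The local estimate is relative to the standard function `VJ`, not to `UJ`. The triangle
  -- inequality bounds the norm of `VJ` by that of `UJ` plus that of the difference; absorbing the
  -- difference replaces `e` by `e / (1 - e)`.
  have hzJ0 : ‖T₀ (UJ - VJ)‖ ≤ e / (1 - e) * ‖T₀ UJ‖ := by
    have h1 := hcomp VJ UJ hcJ
    have h2 : ‖T₀ VJ‖ ≤ ‖T₀ UJ‖ + ‖T₀ (UJ - VJ)‖ := by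
      rw [map_sub]
      simpa using norm_sub_le (T₀ UJ) (T₀ UJ - T₀ VJ)
    rw [div_mul_eq_mul_div, le_div_iff₀ (by linarith)]
    nlinarith
  have hzJ : ‖T (UJ - VJ)‖ ≤ √2 * s * (e / (1 - e)) * ‖T UJ‖ := by
    have he' : 0 ≤ e / (1 - e) := div_nonneg he0 (by linarith)
    calc ‖T (UJ - VJ)‖ ≤ √2 * (e / (1 - e) * ‖T₀ UJ‖) :=
          (hk2 _).trans (mul_le_mul_of_nonneg_left hzJ0 (Real.sqrt_nonneg _))
      _ ≤ √2 * (e / (1 - e) * (s * ‖T UJ‖)) := by gcongr; exact hs2 _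
      _ = _ := by ring
  -- The companions supply admissible test functions: `uJ - zJ` is `vJ` in the standard space and
  -- `uh + zh` is `vh` in the new one. The load `F` cancels because both spaces lie in `H₀¹(D)`.
  have hfin := norm_sub_sq_le_of_galerkin (u := T U) (uh := T Uh) (uJ := T UJ)
    (zh := T (Vh - Uh)) (zJ := T (UJ - VJ))
    (by rw [hT, hT]; exact (huh' _ huh).trans (hu' _ huh.1).symm)
    (by
      rw [← map_sub, sub_sub_cancel, hT, hT]
      exact (huh' _ hvJ).trans (hu' _ hvJ.1).symm)
    (by rw [hT]; exact hcJ.form_eq_zero hcell hl h huh)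
    (by rw [hT, hT]; exact (huJ' _ huJ).trans (hu' _ huJ.1).symm)
    (by
      rw [← map_add, add_sub_cancel, hT, hT]
      exact (huJ' _ hvh).trans (hu' _ hvh.1).symm)
    (by positivity) (mul_nonneg (by positivity) (div_nonneg he0 (by linarith))) hzh hzJ
  rw [← map_sub, ← real_inner_self_eq_norm_sq, ← real_inner_self_eq_norm_sq, hT, hT,
    ← mul_add] at hfin
  exact hfin

end

/-! ## The random coefficient -/

theorem coeff_pos {d : ℕ} {Ω : Type*} {Y : E d → Ω → ℝ} (x : E d) (ω : Ω) : 0 < coeff Y x ω :=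
  Real.exp_pos _

section

variable {d : ℕ} {D : Set (E d)} {Ω : Type*} [MeasurableSpace Ω] {P : Measure Ω} {Y : E d → Ω → ℝ}
  {n : ℕ}

/-- Turns bounds on `D × Ω` into bounds a.e. in `D` for almost every fixed `ω`. -/
theorem ae_ae_of_ae_prod_swap {α β : Type*} [MeasurableSpace α] [MeasurableSpace β]
    {μ : Measure α} {ν : Measure β} [SFinite μ] [SFinite ν] {p : α × β → Prop}
    (h : ∀ᵐ z ∂(μ.prod ν), p z) : ∀ᵐ y ∂ν, ∀ᵐ x ∂μ, p (x, y) :=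
  Measure.ae_ae_of_ae_prod (Measure.measurePreserving_swap.quasiMeasurePreserving.ae h)

theorem TruncatedKL.coeff₀_pos (kl : TruncatedKL D P Y n) (m : ℕ) (x : E d) (ω : Ω) :
    0 < kl.coeff₀ m x ω := Real.exp_pos _

theorem TruncatedKL.aestronglyMeasurable_coeff₀ [SFinite P] (kl : TruncatedKL D P Y n) (m : ℕ)
    (ω : Ω) : AEStronglyMeasurable (fun x => kl.coeff₀ m x ω) (volume.restrict D) := by
  refine Real.continuous_exp.comp_aestronglyMeasurable (AEStronglyMeasurable.add ?_ ?_)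
  · exact (kl.measurable_Y.stronglyMeasurable.integral_prod_right (ν := P)).aestronglyMeasurable
  · exact Finset.aestronglyMeasurable_fun_sum _ fun i _ =>
      ((kl.b_memLp i).1.const_mul _).mul_const _

/-- Only `k` is assumed bounded. From `(1 - η) k₀ ≤ k ≤ (1 + η) k₀` and `η < 1`, bounds `a ≤ k ≤ b`
give `a / 2 ≤ k₀ ≤ b / (1 - η)`. -/
theorem TruncatedKL.isSplitting [SFinite P] (kl : TruncatedKL D P Y n) (m : ℕ) {ω : Ω} {η : ℝ}
    (hη0 : 0 ≤ η) (hη : η < 1)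
    (hk : ∃ a₀ a₁ : ℝ, 0 < a₀ ∧
      ∀ᵐ x ∂(volume.restrict D), a₀ ≤ coeff Y x ω ∧ coeff Y x ω ≤ a₁)
    (h : ∀ᵐ x ∂(volume.restrict D), |kl.coeff₁ m x ω| ≤ η * kl.coeff₀ m x ω) :
    IsSplitting (fun x => coeff Y x ω) (fun x => kl.coeff₀ m x ω) η D := by
  obtain ⟨a, b, ha, hab⟩ := hk
  have hm : Measurable fun x => coeff Y x ω :=
    Real.measurable_exp.comp (kl.measurable_Y.comp measurable_prodMk_right)
  refine ⟨memLp_top_of_bound hm.aestronglyMeasurable b ?_,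
    memLp_top_of_bound (kl.aestronglyMeasurable_coeff₀ m ω) (b / (1 - η)) ?_,
    ⟨a / 2, half_pos ha, ?_⟩, hη0, h⟩
  · filter_upwards [hab] with x hx
    rw [Real.norm_of_nonneg (coeff_pos x ω).le]
    exact hx.2
  · filter_upwards [hab, h] with x hx hx'
    have h1 : kl.coeff₁ m x ω = coeff Y x ω - kl.coeff₀ m x ω := rfl
    rw [Real.norm_of_nonneg (kl.coeff₀_pos m x ω).le, le_div_iff₀ (by linarith)]
    linarith [neg_abs_le (kl.coeff₁ m x ω)]
  · filter_upwards [hab, h] with x hx hx'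
    have h1 : kl.coeff₁ m x ω = coeff Y x ω - kl.coeff₀ m x ω := rfl
    have h2 := mul_le_of_le_one_left (kl.coeff₀_pos m x ω).le hη.le
    exact ⟨by linarith, by linarith [le_abs_self (kl.coeff₁ m x ω)]⟩

/-- Tonelli with `ω` as the outer variable. For fixed `ω` the energy is finite, so the Bochner
integral agrees with the Lebesgue one; the integral over `Ω` may still be infinite. -/
theorem energyNorm_sq [SFinite P] (hY : Measurable (Function.uncurry Y)) {v : Ω → Fun d}
    (hv : AEStronglyMeasurable (fun z : E d × Ω => (v z.2).2 z.1) ((volume.restrict D).prod P))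
    (h : ∀ᵐ ω ∂P, MemLp (fun x => coeff Y x ω) ⊤ (volume.restrict D) ∧
      MemLp (v ω).2 2 (volume.restrict D)) :
    energyNorm D P (coeff Y) v ^ 2 =
      ∫⁻ ω, ENNReal.ofReal (form (fun x => coeff Y x ω) D (v ω) (v ω)) ∂P := by
  have hk : Measurable fun z : E d × Ω => √(coeff Y z.1 z.2) :=
    (Real.measurable_exp.comp hY).sqrt
  have hpow : energyNorm D P (coeff Y) v ^ 2 =
      ∫⁻ z, ‖√(coeff Y z.1 z.2) • (v z.2).2 z.1‖ₑ ^ 2 ∂((volume.restrict D).prod P) := by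
    have := eLpNorm_nnreal_pow_eq_lintegral (p := 2) (μ := (volume.restrict D).prod P)
      (f := fun z : E d × Ω => √(coeff Y z.1 z.2) • (v z.2).2 z.1) two_ne_zero
    simpa [energyNorm] using this
  have hmeas : AEMeasurable (fun z : E d × Ω => ‖√(coeff Y z.1 z.2) • (v z.2).2 z.1‖ₑ ^ 2)
      ((volume.restrict D).prod P) :=
    (hk.aestronglyMeasurable.smul hv).enorm.pow_const 2
  rw [hpow, lintegral_prod_symm _ hmeas]
  refine lintegral_congr_ae ?_
  filter_upwards [h] with ω hω
  rw [form, ofReal_integral_eq_lintegral_ofReal (integrable_weighted_inner hω.1 hω.2 hω.2)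
    (Eventually.of_forall fun x => mul_nonneg (coeff_pos x ω).le real_inner_self_nonneg)]
  refine lintegral_congr fun x => ?_
  rw [real_inner_self_eq_norm_sq, ← ofReal_norm, ← ENNReal.ofReal_pow (norm_nonneg _), norm_smul,
    mul_pow, Real.norm_of_nonneg (Real.sqrt_nonneg _), Real.sq_sqrt (coeff_pos x ω).le]

theorem energyNorm_le_of_form_le [SFinite P] (hY : Measurable (Function.uncurry Y))
    {v u : Ω → Fun d} {C : ℝ}
    (hC : 0 ≤ C)
    (hv : AEStronglyMeasurable (fun z : E d × Ω => (v z.2).2 z.1) ((volume.restrict D).prod P))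
    (hu : AEStronglyMeasurable (fun z : E d × Ω => (u z.2).2 z.1) ((volume.restrict D).prod P))
    (h : ∀ᵐ ω ∂P, MemLp (fun x => coeff Y x ω) ⊤ (volume.restrict D) ∧
      MemLp (v ω).2 2 (volume.restrict D) ∧ MemLp (u ω).2 2 (volume.restrict D) ∧
      form (fun x => coeff Y x ω) D (v ω) (v ω) ≤ C * form (fun x => coeff Y x ω) D (u ω) (u ω)) :
    energyNorm D P (coeff Y) v ≤
      ENNReal.ofReal C ^ (1 / 2 : ℝ) * energyNorm D P (coeff Y) u := by
  have hsq : energyNorm D P (coeff Y) v ^ 2 ≤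
      ENNReal.ofReal C * energyNorm D P (coeff Y) u ^ 2 := by
    rw [energyNorm_sq hY hv (h.mono fun _ hω => ⟨hω.1, hω.2.1⟩),
      energyNorm_sq hY hu (h.mono fun _ hω => ⟨hω.1, hω.2.2.1⟩),
      ← lintegral_const_mul' _ _ ENNReal.ofReal_ne_top]
    refine lintegral_mono_ae ?_
    filter_upwards [h] with ω hω
    rw [← ENNReal.ofReal_mul hC]
    exact ENNReal.ofReal_le_ofReal hω.2.2.2
  have hroot : ∀ x : ℝ≥0∞, (x ^ 2) ^ (1 / 2 : ℝ) = x := fun x => by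
    rw [← ENNReal.rpow_natCast, ← ENNReal.rpow_mul]
    norm_num
  have := ENNReal.rpow_le_rpow hsq (show (0 : ℝ) ≤ 1 / 2 by norm_num)
  rwa [ENNReal.mul_rpow_of_nonneg _ _ (by norm_num), hroot, hroot] at this

end

end MsFEM

end

/-! ### The stochastic estimate, reduced to almost every fixed `ω`. -/

theorem theorem4p1 {d : ℕ} (D : Set (MsFEM.E d)) (hD_open : IsOpen D)
    (hD_conn : IsConnected D) (hD_bdd : Bornology.IsBounded D)
    {Ω : Type*} [MeasurableSpace Ω] (P : Measure Ω) [IsProbabilityMeasure P]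
    (Y : MsFEM.E d → Ω → ℝ) (n m : ℕ) (hmn : m < n) (kl : MsFEM.TruncatedKL D P Y n)
    (hk : ∀ᵐ ω ∂P, ∃ a₀ a₁ : ℝ, 0 < a₀ ∧
      ∀ᵐ x ∂(volume.restrict D), a₀ ≤ MsFEM.coeff Y x ω ∧ MsFEM.coeff Y x ω ≤ a₁)
    (f : MsFEM.E d → ℝ) (hf : MemLp f 2 (volume.restrict D))
    {ι ν : Type*} [Finite ι] [Finite ν]
    (cell : ι → Set (MsFEM.E d)) (hcell : MsFEM.IsPartition D cell)
    (l : Ω → ι → ν → MsFEM.Fun d) (hl : ∀ᵐ ω ∂P, ∀ j i, MsFEM.MemH1 (cell j) (l ω j i))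
    (J : ℕ) (u uh uJh : Ω → MsFEM.Fun d)
    (hu : MsFEM.IsGalerkinSolution D P (MsFEM.coeff Y) f (fun _ => {v | MsFEM.MemH10 D v}) u)
    (huh : MsFEM.IsGalerkinSolution D P (MsFEM.coeff Y) f
      (fun ω => MsFEM.stdSpace D cell (l ω) (fun x => MsFEM.coeff Y x ω)) uh)
    (huJh : MsFEM.IsGalerkinSolution D P (MsFEM.coeff Y) f
      (fun ω => MsFEM.newSpace D cell (l ω) (fun x => kl.coeff₀ m x ω)
        (fun x => kl.coeff₁ m x ω) J) uJh)
    (η c : ℝ≥0∞)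
    (hη_def : η = MsFEM.supNorm D P (fun x ω => kl.coeff₁ m x ω / kl.coeff₀ m x ω))
    (hη : η < 1)
    (hc_def : c = ENNReal.ofReal √2 *
      MsFEM.supNorm D P (fun x ω => √(kl.coeff₀ m x ω / MsFEM.coeff Y x ω))) :
    MsFEM.energyNorm D P (MsFEM.coeff Y) (fun ω => uh ω - uJh ω) ≤
      c ^ (1 / 2 : ℝ) * (η ^ (J + 1) + η ^ (J + 1) / (1 - η ^ (J + 1))) ^ (1 / 2 : ℝ) *
        MsFEM.energyNorm D P (MsFEM.coeff Y) u := by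
  -- The Poincaré inequality needs a coordinate direction. For `d = 0` gradients take values in a
  -- one-point space and the left-hand side is zero.
  rcases Nat.eq_zero_or_pos d with rfl | hd
  · have h0 : MsFEM.energyNorm D P (MsFEM.coeff Y) (fun ω => uh ω - uJh ω) = 0 := by
      rw [MsFEM.energyNorm, Subsingleton.elim (fun z : MsFEM.E 0 × Ω =>
        √(MsFEM.coeff Y z.1 z.2) • (uh z.2 - uJh z.2).2 z.1) 0, eLpNorm_zero]
    rw [h0]
    exact zero_le
  have hη_top : η ≠ ⊤ := hη.ne_top
  have hη1 : η.toReal < 1 := by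
    simpa using (ENNReal.toReal_lt_toReal hη_top ENNReal.one_ne_top).2 hη
  have hk1 : ∀ᵐ z ∂((volume.restrict D).prod P),
      |kl.coeff₁ m z.1 z.2| ≤ η.toReal * kl.coeff₀ m z.1 z.2 := by
    rw [hη_def] at hη_top ⊢
    filter_upwards [MsFEM.ae_norm_le_toReal_eLpNorm_top hη_top] with z hz
    rw [norm_div, div_le_iff₀ (norm_pos_iff.2 (kl.coeff₀_pos m _ _).ne'),
      Real.norm_of_nonneg (kl.coeff₀_pos m _ _).le] at hz
    exact hz
  set S := MsFEM.supNorm D P (fun x ω => √(kl.coeff₀ m x ω / MsFEM.coeff Y x ω)) with hSdef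
  -- `k ≥ (1 - η) k₀` gives `k₀ / k ≤ (1 - η)⁻¹`, so the supremum is automatically finite.
  have hS_top : S ≠ ⊤ := by
    rw [hSdef, MsFEM.supNorm, eLpNorm_exponent_top]
    refine (eLpNormEssSup_lt_top_of_ae_bound (C := √(1 - η.toReal)⁻¹) ?_).ne
    filter_upwards [hk1] with z hz
    have h1 : kl.coeff₁ m z.1 z.2 = MsFEM.coeff Y z.1 z.2 - kl.coeff₀ m z.1 z.2 := rfl
    rw [Real.norm_of_nonneg (Real.sqrt_nonneg _)]
    refine Real.sqrt_le_sqrt ?_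
    rw [div_le_iff₀ (MsFEM.coeff_pos _ _), le_inv_mul_iff₀ (by linarith)]
    linarith [neg_abs_le (kl.coeff₁ m z.1 z.2)]
  have hks : ∀ᵐ z ∂((volume.restrict D).prod P),
      kl.coeff₀ m z.1 z.2 ≤ S.toReal ^ 2 * MsFEM.coeff Y z.1 z.2 := by
    filter_upwards [MsFEM.ae_norm_le_toReal_eLpNorm_top hS_top] with z hz
    rw [Real.norm_of_nonneg (Real.sqrt_nonneg _)] at hz
    rw [← div_le_iff₀ (MsFEM.coeff_pos _ _)]
    exact (Real.sqrt_le_left ENNReal.toReal_nonneg).1 hz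
  have he1 : η.toReal ^ (J + 1) < 1 := pow_lt_one₀ ENNReal.toReal_nonneg hη1 (by omega)
  have he0 : 0 ≤ η.toReal ^ (J + 1) := pow_nonneg ENNReal.toReal_nonneg _
  have hq0 : 0 ≤ η.toReal ^ (J + 1) / (1 - η.toReal ^ (J + 1)) := div_nonneg he0 (by linarith)
  -- All constants are finite, so they can be moved to `ℝ`, where the deterministic estimate lives;
  -- only the energy norm of `u` can be infinite on the right.
  have hconst : c * (η ^ (J + 1) + η ^ (J + 1) / (1 - η ^ (J + 1))) =
      ENNReal.ofReal (√2 * S.toReal *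
        (η.toReal ^ (J + 1) + η.toReal ^ (J + 1) / (1 - η.toReal ^ (J + 1)))) := by
    rw [ENNReal.ofReal_mul (by positivity), ENNReal.ofReal_mul (by positivity),
      ENNReal.ofReal_add he0 hq0, ENNReal.ofReal_div_of_pos (by linarith),
      ENNReal.ofReal_sub _ he0, ENNReal.ofReal_pow ENNReal.toReal_nonneg,
      ENNReal.ofReal_toReal hη_top, ENNReal.ofReal_toReal hS_top, ENNReal.ofReal_one, hc_def]
  rw [← ENNReal.mul_rpow_of_nonneg _ _ (by norm_num), hconst]
  refine MsFEM.energyNorm_le_of_form_le kl.measurable_Y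
    (mul_nonneg (by positivity) (add_nonneg he0 hq0)) (huh.1.2.sub huJh.1.2) hu.1.2 ?_
  filter_upwards [hk, hl, hu.2, huh.2, huJh.2, MsFEM.ae_ae_of_ae_prod_swap hk1,
    MsFEM.ae_ae_of_ae_prod_swap hks] with ω hkω hlω huω huhω huJω hk1ω hksω
  have hsplit := kl.isSplitting m ENNReal.toReal_nonneg hη1 hkω hk1ω
  exact ⟨hsplit.memLp, huhω.1.1.2.1.sub huJω.1.1.2.1, huω.1.2.1,
    MsFEM.form_sub_le_of_galerkin ⟨0, hd⟩ hD_bdd hcell hlω hsplit hη1 ENNReal.toReal_nonneg hksω J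
      huω.1 huω.2 huhω.1 huhω.2 huJω.1 huJω.2⟩
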